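/- Let $d\in\{2,3\}$, let $\Omega\subset\mathbb R^d$ be a bounded open set, and let $k\ge 2$, $\sigma,C,\beta>0$. Write $(\cdot,\cdot)$ and $\|\cdot\|_0$ for the inner product and norm of $L^2(\Omega)$, $\|\cdot\|_{m}$, $\|\cdot\|_{m,T}$ for the norms of $H^m(\Omega)$, $H^m(T)$, and $|\cdot|_{m}$, $|\cdot|_{m,T}$ for the seminorms formed by the derivatives of order exactly $m$. Let $\mathbf V=H^1_0(\Omega;\mathbb R^d)$, $a(\mathbf u,\mathbf v)=2\mu(\varepsilon(\mathbf u),\varepsilon(\mathbf v))$ and $b(q,\mathbf v)=(q,\nabla\cdot\mathbf v)$, where $\varepsilon$ is the symmetric gradient. A *discretization* consists of a finite set $\mathcal T_h$ of pairwise disjoint nonempty open sets $T\subset\Omega$ that cover $\Omega$ up to a null set, with $h_T=\operatorname{diam}T$ and $h=\max_T h_T$; finite-dimensional subspaces $\mathbf V_h\subset\mathbf V$, $Q_h\subset L^2(\Omega)$, $\widetilde{\mathbf Q}_h\subset L^2(\Omega;\mathbb R^d)$; and a linear operator $\pi^{\rm div}\colon\mathbf V_h\to H^{\rm div}(\Omega)$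 such that, for all $\mathbf v_h\in\mathbf V_h$: $\nabla\cdot\pi^{\rm div}\mathbf v_h\in Q_h$ and $b(q_h,\pi^{\rm div}\mathbf v_h)=b(q_h,\mathbf v_h)$ for all $q_h\in Q_h$ (that is, $\nabla\cdot\pi^{\rm div}\mathbf v_h$ is the $L^2$-projection of $\nabla\cdot\mathbf v_h$ onto $Q_h$); $\nabla\cdot\pi^{\rm div}\mathbf v_h=0$ if $b(q_h,\mathbf v_h)=0$ for all $q_h\in Q_h$; and $\pi^{\rm div}\mathbf v_h\cdot\mathbf n=0$ on $\partial\Omega$, in the sense that $(\pi^{\rm div}\mathbf v_h,\nabla\varphi)+(\nabla\cdot\pi^{\rm div}\mathbf v_h,\varphi)=0$ for all $\varphi\in H^1(\Omega)$. Consider the following assumptions on a discretization. 1. (Shape regularity) Each $T\in\mathcal T_h$ contains a ball of radius $h_T/\sigma$. 2. (Finite element spaces) There is an operator $I_h\colon H^{k+1}(\Omega;\mathbb R^d)\cap\mathbf V\to\mathbf V_h$ with $h_T^i\|I_h\mathbf v-\mathbf v\|_{i,T}\le C h_T^{k+1}\|\mathbf v\|_{k+1,T}$ for $i=0,1$, all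 $\mathbf v$ and all $T\in\mathcal T_h$. The $L^2$-projection $\pi^{L^2}$ onto $Q_h$ satisfies $\|\pi^{L^2}q-q\|_{0,T}\le C h_T^{k}\|q\|_{k,T}$ for all $q\in H^k(\Omega)$ with $\int_\Omega q=0$ and all $T$. The $L^2$-projection $\pi^{L^2}$ onto $\widetilde{\mathbf Q}_h$ satisfies $\|\pi^{L^2}\mathbf q-\mathbf q\|_{0,T}\le C h_T^{k-1}\|\mathbf q\|_{k-1,T}$ for all $\mathbf q\in H^{k-1}(\Omega;\mathbb R^d)$ and all $T$. Moreover the inf-sup condition $$\sup_{0\ne\mathbf v_h\in\mathbf V_h}\frac{(q_h,\nabla\cdot\mathbf v_h)}{|\mathbf v_h|_1}\ge\beta\|q_h\|_0$$ (the supremum being read as $0$ if $\mathbf V_h=\{0\}$) holds for all $q_h\in Q_h$, where, if $Q_h$ contains the constant functions, only those $q_h$ with $\int_\Omega q_h=0$ are considered. 3. (Reconstruction) $(\mathbf v_h-\pi^{\rm div}\mathbf v_h,\mathbf q)=0$ for all $\mathbf v_h\in\mathbf V_h$, $\mathbf q\in\widetilde{\mathbf Q}_h$; and $\|\pi^{\rm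 div}\mathbf v_h-\mathbf v_h\|_{0,T}\le C h_T^m|\mathbf v_h|_{m,T}$ for all $\mathbf v_h\in\mathbf V_h$, $T\in\mathcal T_h$, $m=0,1$. **Theorem.** There is a constant $c>0$, depending only on $d,\Omega,k,\sigma,C,\beta$, such that the following holds for every discretization with properties 1–3, all $\mu,\lambda\in(0,\infty)$ and all $\mathbf f\in L^2(\Omega;\mathbb R^d)$. Let $(\mathbf u,p)\in\mathbf V\times L^2(\Omega)$ be the weak solution of $$-2\mu\nabla\cdot\varepsilon(\mathbf u)-\nabla p=\mathbf f,\qquad \nabla\cdot\mathbf u-\tfrac1\lambda p=0\quad\text{in }\Omega,\qquad \mathbf u=0\quad\text{on }\partial\Omega,$$ and suppose that $(\mathbf u,p)\in H^{k+1}(\Omega;\mathbb R^d)\times H^k(\Omega)$. Let $(\mathbf u_h,p_h)\in\mathbf V_h\times Q_h$ solve the modified discrete problem $$a(\mathbf u_h,\mathbf v_h)+b(p_h,\mathbf v_h)=(\mathbf f,\pi^{\rm div}\mathbf v_h)\quad\forall\,\mathbf v_h\in\mathbf V_h,\qquad b(q_h,\mathbf u_h)-\tfrac1\lambda(p_h,q_h)=0\quad\forall\,q_h\in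 Q_h.$$ Then $$\|\mathbf u-\mathbf u_h\|_1\le c\,h^k\Bigl(1+\sqrt{\tfrac{\mu}{\lambda}}\Bigr)\|\mathbf u\|_{k+1}+c\,\frac{h^k}{\mu\lambda}\|p\|_k .$$ -/

import Mathlib

open MeasureTheory
open scoped ContDiff ENNReal

/-- The Euclidean space `ℝ^d`. -/
abbrev Eucl (d : ℕ) : Type := EuclideanSpace ℝ (Fin d)

/-- The Hilbert space `L²(Ω; F)`. Its norm and inner product are those of Mathlib's `Lp`. -/
abbrev L2 {d : ℕ} (Ω : Set (Eucl d)) (F : Type) [NormedAddCommGroup F] : Type :=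
  Lp F 2 (volume.restrict Ω)

/-- Test functions: smooth, with compact support contained in `U`. -/
def IsTest {d : ℕ} {F : Type} [NormedAddCommGroup F] [NormedSpace ℝ F]
    (U : Set (Eucl d)) (φ : Eucl d → F) : Prop :=
  ContDiff ℝ ∞ φ ∧ HasCompactSupport φ ∧ tsupport φ ⊆ U

/-- The classical derivative `∂_{I 0} ⋯ ∂_{I (j-1)} φ` at `x`. -/
noncomputable def partialDeriv {d j : ℕ} (I : Fin j → Fin d) (φ : Eucl d → ℝ) (x : Eucl d) : ℝ :=
  iteratedFDeriv ℝ j φ x (fun l => EuclideanSpace.single (I l) (1 : ℝ))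

/-- `g ∈ L²(U)` is the weak derivative `∂_{I 0} ⋯ ∂_{I (j-1)} u` of `u ∈ L²(U)` in the open
set `U`. -/
def IsWeakDeriv {d j : ℕ} {F : Type} [NormedAddCommGroup F] [NormedSpace ℝ F]
    (U : Set (Eucl d)) (I : Fin j → Fin d) (u g : Eucl d → F) : Prop :=
  MemLp u 2 (volume.restrict U) ∧ MemLp g 2 (volume.restrict U) ∧
    ∀ φ : Eucl d → ℝ, IsTest U φ →
      ∫ x in U, partialDeriv I φ x • u x = (-1 : ℝ) ^ j • ∫ x in U, φ x • g x

/-- `u ∈ H^m(U)`: all weak derivatives of order at most `m` exist in `L²(U)`. -/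
def MemSobolev {d : ℕ} {F : Type} [NormedAddCommGroup F] [NormedSpace ℝ F]
    (U : Set (Eucl d)) (m : ℕ) (u : Eucl d → F) : Prop :=
  ∀ j ≤ m, ∀ I : Fin j → Fin d, ∃ g, IsWeakDeriv U I u g

/-- The seminorm `|u|_{j,U}`, i.e. the `L²(U)` norm of the tensor of all weak derivatives of order
`j`. Weak derivatives are unique almost everywhere, so each infimum is the norm of the
derivative; the value is `⊤` if one of the derivatives does not exist in `L²(U)`. -/
noncomputable def sobolevSeminorm {d : ℕ} {F : Type} [NormedAddCommGroup F] [NormedSpace ℝ F]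
    (U : Set (Eucl d)) (j : ℕ) (u : Eucl d → F) : ℝ≥0∞ :=
  (∑ I : Fin j → Fin d,
    (⨅ (g : Eucl d → F) (_ : IsWeakDeriv U I u g), eLpNorm g 2 (volume.restrict U)) ^ 2)
      ^ (1 / 2 : ℝ)

/-- The norm `‖u‖_{m,U}` of `H^m(U)`, with value `⊤` outside of `H^m(U)`. -/
noncomputable def sobolevNorm {d : ℕ} {F : Type} [NormedAddCommGroup F] [NormedSpace ℝ F]
    (U : Set (Eucl d)) (m : ℕ) (u : Eucl d → F) : ℝ≥0∞ :=
  (∑ j ∈ Finset.range (m + 1), sobolevSeminorm U j u ^ 2) ^ (1 / 2 : ℝ)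

/-- `u ∈ H^1_0(Ω; F)`, the closure of the test functions in `H^1(Ω; F)`. -/
def MemH10 {d : ℕ} {F : Type} [NormedAddCommGroup F] [NormedSpace ℝ F]
    (Ω : Set (Eucl d)) (u : Eucl d → F) : Prop :=
  MemSobolev Ω 1 u ∧ ∀ ε : ℝ≥0∞, 0 < ε →
    ∃ φ : Eucl d → F, IsTest Ω φ ∧ sobolevNorm Ω 1 (fun x => u x - φ x) < ε

open Classical in
/-- The weak partial derivative `∂_i u` as an element of `L²(Ω)` (`0` if it does not exist). -/
noncomputable def weakPartial {d : ℕ} {F : Type} [NormedAddCommGroup F] [NormedSpace ℝ F]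
    (Ω : Set (Eucl d)) (i : Fin d) (u : L2 Ω F) : L2 Ω F :=
  if h : ∃ g : L2 Ω F, IsWeakDeriv Ω ![i] u g then h.choose else 0

/-- `g ∈ L²(Ω)` is the weak divergence of `v ∈ L²(Ω; ℝ^d)`. -/
def IsWeakDiv {d : ℕ} (Ω : Set (Eucl d)) (v : L2 Ω (Eucl d)) (g : L2 Ω ℝ) : Prop :=
  ∀ φ : Eucl d → ℝ, IsTest Ω φ →
    ∫ x in Ω, ∑ i, v x i * partialDeriv ![i] φ x = - ∫ x in Ω, g x * φ x

/-- `v ∈ H^div(Ω)`. -/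
def MemHdiv {d : ℕ} (Ω : Set (Eucl d)) (v : L2 Ω (Eucl d)) : Prop :=
  ∃ g : L2 Ω ℝ, IsWeakDiv Ω v g

open Classical in
/-- The weak divergence as an element of `L²(Ω)` (`0` outside of `H^div(Ω)`). -/
noncomputable def weakDiv {d : ℕ} (Ω : Set (Eucl d)) (v : L2 Ω (Eucl d)) : L2 Ω ℝ :=
  if h : MemHdiv Ω v then h.choose else 0

/-- `v · n = 0` on `∂Ω` for `v ∈ H^div(Ω)`, in the usual weak sense
`(v, ∇φ) + (∇ · v, φ) = 0` for all `φ ∈ H^1(Ω)`. -/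
def HasZeroNormalTrace {d : ℕ} (Ω : Set (Eucl d)) (v : L2 Ω (Eucl d)) : Prop :=
  ∀ φ : L2 Ω ℝ, MemSobolev Ω 1 φ →
    (∫ x in Ω, ∑ i, v x i * weakPartial Ω i φ x) + inner ℝ (weakDiv Ω v) φ = 0

/-- The symmetric gradient `ε(u)`. -/
noncomputable def strain {d : ℕ} (Ω : Set (Eucl d)) (u : L2 Ω (Eucl d)) (x : Eucl d) :
    Matrix (Fin d) (Fin d) ℝ :=
  Matrix.of fun i j => (weakPartial Ω j u x i + weakPartial Ω i u x j) / 2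

/-- `a(u, v) = 2 μ (ε(u), ε(v))`. -/
noncomputable def formA {d : ℕ} (Ω : Set (Eucl d)) (μ : ℝ) (u v : L2 Ω (Eucl d)) : ℝ :=
  2 * μ * ∫ x in Ω, ∑ i, ∑ j, strain Ω u x i j * strain Ω v x i j

/-- `b(q, v) = (q, ∇ · v)`. -/
noncomputable def formB {d : ℕ} (Ω : Set (Eucl d)) (q : L2 Ω ℝ) (v : L2 Ω (Eucl d)) : ℝ :=
  inner ℝ q (weakDiv Ω v)

/-- `(u, p) ∈ H^1_0(Ω; ℝ^d) × L²(Ω)` is the weak solution of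
`-2μ ∇·ε(u) - ∇p = f`, `∇·u - p/λ = 0` in `Ω`, `u = 0` on `∂Ω`. -/
def IsElasticitySolution {d : ℕ} (Ω : Set (Eucl d)) (μ lam : ℝ) (f u : L2 Ω (Eucl d))
    (p : L2 Ω ℝ) : Prop :=
  MemH10 Ω u ∧
  (∀ v : L2 Ω (Eucl d), MemH10 Ω v → formA Ω μ u v + formB Ω p v = inner ℝ f v) ∧
  (∀ q : L2 Ω ℝ, formB Ω q u - 1 / lam * inner ℝ p q = 0)

/-- A decomposition of `Ω` with discrete spaces `V_h`, `Q_h`, the auxiliary space `Q̃_h`, and a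
reconstruction operator `π^div`. -/
structure MixedDiscretization {d : ℕ} (Ω : Set (Eucl d)) where
  /-- The (open) elements of the decomposition. -/
  cells : Finset (Set (Eucl d))
  cells_open : ∀ T ∈ cells, IsOpen T
  cells_nonempty : ∀ T ∈ cells, T.Nonempty
  cells_subset : ∀ T ∈ cells, T ⊆ Ω
  cells_disjoint : ∀ T ∈ cells, ∀ T' ∈ cells, T ≠ T' → Disjoint T T'
  cells_cover : volume (Ω \ ⋃ T ∈ cells, T) = 0
  /-- `V_h ⊂ H^1_0(Ω; ℝ^d)`. -/
  V : Submodule ℝ (L2 Ω (Eucl d))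
  V_finite : FiniteDimensional ℝ V
  V_sub : ∀ v ∈ V, MemH10 Ω v
  /-- `Q_h ⊂ L²(Ω)`. -/
  Q : Submodule ℝ (L2 Ω ℝ)
  Q_finite : FiniteDimensional ℝ Q
  /-- `Q̃_h ⊂ L²(Ω; ℝ^d)`. -/
  Qt : Submodule ℝ (L2 Ω (Eucl d))
  Qt_finite : FiniteDimensional ℝ Qt
  /-- `π^div : V_h → H^div(Ω)`. -/
  recon : V →ₗ[ℝ] L2 Ω (Eucl d)
  recon_mem : ∀ v : V, MemHdiv Ω (recon v)
  /-- Commuting diagram `∇ · π^div v_h = π^{L²} ∇ · v_h`: the divergence of `π^div v_h` is in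
  `Q_h`, and it is tested by `Q_h` as the divergence of `v_h`. -/
  recon_div_mem : ∀ v : V, weakDiv Ω (recon v) ∈ Q
  recon_comm : ∀ v : V, ∀ q ∈ Q, formB Ω q (recon v) = formB Ω q v
  /-- Discretely divergence free functions are mapped to divergence free functions. -/
  recon_ker : ∀ v : V, (∀ q ∈ Q, formB Ω q v = 0) → weakDiv Ω (recon v) = 0
  recon_trace : ∀ v : V, HasZeroNormalTrace Ω (recon v)

attribute [instance] MixedDiscretization.V_finite MixedDiscretization.Q_finite
  MixedDiscretization.Qt_finite

namespace MixedDiscretization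

variable {d : ℕ} {Ω : Set (Eucl d)}

/-- The mesh size `h = max_T h_T`, where `h_T` is the diameter of `T`. -/
noncomputable def meshSize (D : MixedDiscretization Ω) : ℝ :=
  ⨆ T : D.cells, Metric.diam (T : Set (Eucl d))

/-- Shape regularity with parameter `σ`: each element `T` contains a ball of radius `h_T / σ`. -/
def ShapeRegular (D : MixedDiscretization Ω) (σ : ℝ) : Prop :=
  ∀ T ∈ D.cells, ∃ x, Metric.ball x (Metric.diam T / σ) ⊆ T

/-- The inf-sup condition with constant `β`. If `Q_h` contains the constants (which are
`b`-orthogonal to `H^1_0`), then only the functions of `Q_h` with mean value zero are tested;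
otherwise all functions of `Q_h` are. The quotient at `v = 0` is `0` and does not matter. -/
def InfSup (D : MixedDiscretization Ω) (β : ℝ) : Prop :=
  ∀ q ∈ D.Q, ((∃ r ∈ D.Q, ⇑r =ᵐ[volume.restrict Ω] fun _ => (1 : ℝ)) → ∫ x in Ω, q x = 0) →
    β * ‖q‖ ≤ ⨆ v : D.V, formB Ω q v / (sobolevSeminorm Ω 1 (v : L2 Ω (Eucl d))).toReal

/-- Approximation properties of order `k` (with constant `C`) of `V_h`, `Q_h`, `Q̃_h`, and the
inf-sup condition (with constant `β`). The projections `π^{L²}` are the `L²(Ω)`-orthogonal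
projections onto `Q_h` and `Q̃_h`. -/
structure FESpaceAssumption (D : MixedDiscretization Ω) (k : ℕ) (C β : ℝ) : Prop where
  interpolation : ∃ Ih : L2 Ω (Eucl d) → L2 Ω (Eucl d),
    ∀ v : L2 Ω (Eucl d), MemSobolev Ω (k + 1) v → MemH10 Ω v →
      Ih v ∈ D.V ∧ ∀ T ∈ D.cells, ∀ i ≤ 1,
        ENNReal.ofReal (Metric.diam T ^ i) * sobolevNorm T i ⇑(Ih v - v) ≤
          ENNReal.ofReal (C * Metric.diam T ^ (k + 1)) * sobolevNorm T (k + 1) v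
  projection : ∀ q : L2 Ω ℝ, MemSobolev Ω k q → ∫ x in Ω, q x = 0 →
    ∀ T ∈ D.cells, eLpNorm ⇑(D.Q.starProjection q - q) 2 (volume.restrict T) ≤
      ENNReal.ofReal (C * Metric.diam T ^ k) * sobolevNorm T k q
  infSup : D.InfSup β
  projection_aux : ∀ q : L2 Ω (Eucl d), MemSobolev Ω (k - 1) q →
    ∀ T ∈ D.cells, eLpNorm ⇑(D.Qt.starProjection q - q) 2 (volume.restrict T) ≤
      ENNReal.ofReal (C * Metric.diam T ^ (k - 1)) * sobolevNorm T (k - 1) q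

/-- Orthogonality and local approximation property (with constant `C`) of `π^div`. -/
structure ReconAssumption (D : MixedDiscretization Ω) (C : ℝ) : Prop where
  ortho : ∀ v : D.V, ∀ q ∈ D.Qt, inner ℝ ((v : L2 Ω (Eucl d)) - D.recon v) q = 0
  approx : ∀ v : D.V, ∀ T ∈ D.cells, ∀ m ≤ 1,
    eLpNorm ⇑(D.recon v - (v : L2 Ω (Eucl d))) 2 (volume.restrict T) ≤
      ENNReal.ofReal (C * Metric.diam T ^ m) * sobolevSeminorm T m (v : L2 Ω (Eucl d))

/-- `(u_h, p_h) ∈ V_h × Q_h` solves the modified discrete problem, in which the load `f` is tested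
with `π^div v_h`. -/
def IsModifiedSolution (D : MixedDiscretization Ω) (μ lam : ℝ) (f uh : L2 Ω (Eucl d))
    (ph : L2 Ω ℝ) : Prop :=
  uh ∈ D.V ∧ ph ∈ D.Q ∧
  (∀ v : D.V, formA Ω μ uh v + formB Ω ph v = inner ℝ f (D.recon v)) ∧
  (∀ q ∈ D.Q, formB Ω q uh - 1 / lam * inner ℝ ph q = 0)

end MixedDiscretization

/-! ### Test functions and their classical derivatives -/

section TestFunctions

variable {d : ℕ} {F : Type} [NormedAddCommGroup F] [NormedSpace ℝ F] {U V : Set (Eucl d)}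

/-! The modified load makes the scheme pressure-robust. Since `u` is in `H²` and `p` in `H¹`, the
equation holds in strong form, `f = -2μ div ε(u) - ∇p` (`IsElasticitySolution.strong_form`). Tested
with `π^div v`, which has zero normal trace and a divergence in `Q_h`, the part `-∇p` becomes `b(πp,
v)`, with `πp` the projection of `p` onto `Q_h`. Hence, with `η = u_h - u` and `r = p_h - πp`, `a(η,
v) + b(r, v) = 2μ (div ε(u), v - π^div v)` (`error_equation`). The right side is `2μ` times a
quantity of order `h^k`: orthogonality to `Q̃_h` allows the projection of `div ε(u)` to be
subtracted, which gains `h^(k-1)`, and the reconstruction gains one more `h`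
(`ReconAssumption.abs_inner_le`).

Now let `v = u_h - w` with the interpolant `w` of `u`. The second equations give `b(r, η) = ‖r‖²/λ ≥
0`, a term of favourable sign for every `λ` (`formB_sub_nonneg`), and the inf-sup condition bounds
`‖r‖` by a multiple of `μ`. So every remaining term carries the factor `μ`, Korn's inequality lets
it cancel, and a quadratic inequality for `|η|_1` remains whose coefficients do not depend on `μ`
and `λ` (`IsModifiedSolution.gradNorm_sub_le`). Poincaré's inequality passes to the full norm. The
outcome is `‖u - u_h‖_1 ≤ c h^k ‖u‖_{k+1}`, from which the asserted bound follows by adding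
nonnegative terms.

The facts about `H^1_0` (integration by parts, Korn, Poincaré) are proved for test functions and
pass to the closure of the graph of the gradient (`h10Graph_subset`). -/

theorem IsTest.mono {φ : Eucl d → F} (h : IsTest U φ) (hUV : U ⊆ V) : IsTest V φ :=
  ⟨h.1, h.2.1, h.2.2.trans hUV⟩

theorem IsTest.memLp {φ : Eucl d → F} (h : IsTest U φ) (p : ℝ≥0∞) :
    MemLp φ p (volume.restrict U) :=
  (h.1.continuous.memLp_of_hasCompactSupport (μ := volume) h.2.1).restrict U

theorem IsTest.zero_of_notMem {φ : Eucl d → F} (h : IsTest U φ) {x : Eucl d} (hx : x ∉ U) :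
    φ x = 0 :=
  image_eq_zero_of_notMem_tsupport fun hx' => hx (h.2.2 hx')

theorem IsTest.setIntegral_mul {φ : Eucl d → ℝ} (h : IsTest U φ) (g : Eucl d → ℝ) :
    ∫ x in U, φ x * g x = ∫ x, φ x * g x :=
  setIntegral_eq_integral_of_forall_compl_eq_zero fun x hx => by simp [h.zero_of_notMem hx]

theorem IsTest.differentiable {φ : Eucl d → F} (h : IsTest U φ) : Differentiable ℝ φ :=
  h.1.differentiable (by simp)

theorem IsTest.partialDeriv {φ : Eucl d → ℝ} (h : IsTest U φ) {j : ℕ} (I : Fin j → Fin d) :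
    IsTest U (partialDeriv I φ) := by
  have hsub : tsupport (_root_.partialDeriv I φ) ⊆ tsupport φ := by
    refine (closure_mono fun x hx => ?_).trans (tsupport_iteratedFDeriv_subset (𝕜 := ℝ) j)
    intro h0
    exact hx (by simp [_root_.partialDeriv, h0])
  refine ⟨?_, h.2.1.of_isClosed_subset (isClosed_tsupport _) hsub, hsub.trans h.2.2⟩
  have : ContDiff ℝ ∞ (iteratedFDeriv ℝ j φ) := h.1.iteratedFDeriv_right (by norm_cast)
  exact (ContinuousMultilinearMap.apply ℝ (fun _ : Fin j => Eucl d) ℝ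
    (fun l => EuclideanSpace.single (I l) (1 : ℝ))).contDiff.comp this

theorem IsTest.clm_comp {G : Type} [NormedAddCommGroup G] [NormedSpace ℝ G]
    {φ : Eucl d → F} (h : IsTest U φ) (L : F →L[ℝ] G) : IsTest U (fun x => L (φ x)) :=
  ⟨L.contDiff.comp h.1, h.2.1.comp_left (g := L) (map_zero L),
    (tsupport_comp_subset (map_zero L) φ).trans h.2.2⟩

theorem IsTest.smul_const {φ : Eucl d → ℝ} (h : IsTest U φ) (w : F) :
    IsTest U (fun x => φ x • w) :=
  h.clm_comp ((1 : ℝ →L[ℝ] ℝ).smulRight w)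

theorem IsTest.dirDeriv {φ : Eucl d → F} (h : IsTest U φ) (w : Eucl d) :
    IsTest U (fun x => fderiv ℝ φ x w) := by
  have hsub : tsupport (fun x => fderiv ℝ φ x w) ⊆ tsupport φ := by
    refine (closure_mono fun x hx => ?_).trans (tsupport_fderiv_subset ℝ)
    intro h0
    exact hx (by simp [h0])
  refine ⟨?_, h.2.1.of_isClosed_subset (isClosed_tsupport _) hsub, hsub.trans h.2.2⟩
  exact (h.1.fderiv_right (m := ∞) (by norm_cast)).clm_apply contDiff_const

theorem partialDeriv_zero (I : Fin 0 → Fin d) (φ : Eucl d → ℝ) : partialDeriv I φ = φ := by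
  ext x; simp [partialDeriv]

theorem partialDeriv_one (i : Fin d) (φ : Eucl d → ℝ) (x : Eucl d) :
    partialDeriv ![i] φ x = fderiv ℝ φ x (EuclideanSpace.single i 1) := by
  simp [partialDeriv]

/-- The first index is the outermost derivative. Weak derivatives can therefore be peeled off from
the front with no appeal to symmetry of higher derivatives. -/
theorem partialDeriv_cons {φ : Eucl d → ℝ} (h : ContDiff ℝ ∞ φ) {j : ℕ} (i : Fin d)
    (I : Fin j → Fin d) :
    partialDeriv (Matrix.vecCons i I) φ = partialDeriv ![i] (partialDeriv I φ) := by
  ext x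
  rw [partialDeriv_one]
  have hd : DifferentiableAt ℝ (iteratedFDeriv ℝ j φ) x :=
    (h.differentiable_iteratedFDeriv (by exact_mod_cast ENat.natCast_lt_top j)) x
  have := ((ContinuousMultilinearMap.apply ℝ (fun _ : Fin j => Eucl d) ℝ
    (fun l => EuclideanSpace.single (I l) (1 : ℝ))).hasFDerivAt.comp x hd.hasFDerivAt).fderiv
  change _ = (fderiv ℝ ((ContinuousMultilinearMap.apply ℝ (fun _ : Fin j => Eucl d) ℝ
    (fun l => EuclideanSpace.single (I l) (1 : ℝ))) ∘ (iteratedFDeriv ℝ j φ)) x) _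
  rw [this]
  simp only [partialDeriv, iteratedFDeriv_succ_apply_left]
  rfl

/-- Integration by parts for a test function and a smooth function. -/
theorem IsTest.integral_fderiv_mul {φ ψ : Eucl d → ℝ} (h : IsTest U φ) (hψ : ContDiff ℝ ∞ ψ)
    (w : Eucl d) :
    ∫ x, fderiv ℝ φ x w * ψ x = - ∫ x, φ x * fderiv ℝ ψ x w := by
  have hc : Continuous fun x => fderiv ℝ ψ x w :=
    (hψ.continuous_fderiv (by simp)).clm_apply continuous_const
  rw [integral_mul_fderiv_eq_neg_fderiv_mul_of_integrable, neg_neg]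
  · exact ((h.dirDeriv w).1.continuous.mul hψ.continuous).integrable_of_hasCompactSupport
      (h.dirDeriv w).2.1.mul_right
  · exact (h.1.continuous.mul hc).integrable_of_hasCompactSupport h.2.1.mul_right
  · exact (h.1.continuous.mul hψ.continuous).integrable_of_hasCompactSupport h.2.1.mul_right
  · exact fun x _ => h.differentiable x
  · exact fun x _ => hψ.differentiable (by simp) x

theorem IsTest.integral_fderiv {φ : Eucl d → ℝ} (h : IsTest U φ) (w : Eucl d) :
    ∫ x, fderiv ℝ φ x w = 0 := by
  simpa using h.integral_fderiv_mul (contDiff_const (c := (1 : ℝ))) w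

end TestFunctions

/-! ### Calculus of weak derivatives -/

section WeakDerivatives

variable {d : ℕ} {F : Type} [NormedAddCommGroup F] [NormedSpace ℝ F] {U V : Set (Eucl d)}

theorem IsTest.integrable_smul {φ : Eucl d → ℝ} (h : IsTest U φ) {u : Eucl d → F}
    (hu : MemLp u 2 (volume.restrict U)) :
    Integrable (fun x => φ x • u x) (volume.restrict U) :=
  memLp_one_iff_integrable.1 (hu.smul (h.memLp 2))

theorem IsTest.setIntegral_of_subset {φ : Eucl d → ℝ} (h : IsTest U φ) (hUV : U ⊆ V)
    (u : Eucl d → F) : ∫ x in V, φ x • u x = ∫ x in U, φ x • u x := by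
  rw [setIntegral_eq_integral_of_forall_compl_eq_zero fun x hx => by
      simp [(h.mono hUV).zero_of_notMem hx],
    setIntegral_eq_integral_of_forall_compl_eq_zero fun x hx => by
      simp [h.zero_of_notMem hx]]

namespace IsWeakDeriv

variable {j : ℕ} {I : Fin j → Fin d} {u u' g g' : Eucl d → F}

theorem congr (h : IsWeakDeriv U I u g) (hu : u =ᵐ[volume.restrict U] u')
    (hg : g =ᵐ[volume.restrict U] g') : IsWeakDeriv U I u' g' := by
  refine ⟨h.1.ae_eq hu, h.2.1.ae_eq hg, fun φ hφ => ?_⟩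
  have h1 : ∫ x in U, partialDeriv I φ x • u' x = ∫ x in U, partialDeriv I φ x • u x :=
    integral_congr_ae (hu.mono fun x hx => by simp only [hx])
  have h2 : ∫ x in U, φ x • g' x = ∫ x in U, φ x • g x :=
    integral_congr_ae (hg.mono fun x hx => by simp only [hx])
  rw [h1, h2, h.2.2 φ hφ]

theorem mono (h : IsWeakDeriv V I u g) (hUV : U ⊆ V) : IsWeakDeriv U I u g := by
  refine ⟨h.1.mono_measure (Measure.restrict_mono_set _ hUV),
    h.2.1.mono_measure (Measure.restrict_mono_set _ hUV), fun φ hφ => ?_⟩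
  rw [← (hφ.partialDeriv I).setIntegral_of_subset hUV,
    ← hφ.setIntegral_of_subset hUV]
  exact h.2.2 φ (hφ.mono hUV)

theorem add (h : IsWeakDeriv U I u g) (h' : IsWeakDeriv U I u' g') :
    IsWeakDeriv U I (u + u') (g + g') := by
  refine ⟨h.1.add h'.1, h.2.1.add h'.2.1, fun φ hφ => ?_⟩
  simp only [Pi.add_apply, smul_add]
  rw [integral_add ((hφ.partialDeriv I).integrable_smul h.1)
    ((hφ.partialDeriv I).integrable_smul h'.1), integral_add (hφ.integrable_smul h.2.1)
    (hφ.integrable_smul h'.2.1), h.2.2 φ hφ, h'.2.2 φ hφ, smul_add]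

theorem clm_comp {G : Type} [NormedAddCommGroup G] [NormedSpace ℝ G] [CompleteSpace F]
    [CompleteSpace G] (h : IsWeakDeriv U I u g) (L : F →L[ℝ] G) :
    IsWeakDeriv U I (fun x => L (u x)) (fun x => L (g x)) := by
  refine ⟨L.comp_memLp' h.1, L.comp_memLp' h.2.1, fun φ hφ => ?_⟩
  simp only [← map_smul]
  rw [L.integral_comp_comm ((hφ.partialDeriv I).integrable_smul h.1),
    L.integral_comp_comm (hφ.integrable_smul h.2.1), h.2.2 φ hφ, map_smul]

theorem const_smul (h : IsWeakDeriv U I u g) (c : ℝ) : IsWeakDeriv U I (c • u) (c • g) := by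
  refine ⟨h.1.const_smul c, h.2.1.const_smul c, fun φ hφ => ?_⟩
  simp only [Pi.smul_apply, smul_comm _ c, integral_smul]
  rw [h.2.2 φ hφ, smul_comm]

theorem sub (h : IsWeakDeriv U I u g) (h' : IsWeakDeriv U I u' g') :
    IsWeakDeriv U I (u - u') (g - g') := by
  simpa [sub_eq_add_neg] using h.add (h'.const_smul (-1))

theorem zero : IsWeakDeriv U I (0 : Eucl d → F) 0 :=
  ⟨MemLp.zero, MemLp.zero, fun φ _ => by simp⟩

theorem sum {ι : Type*} (s : Finset ι) {u g : ι → Eucl d → F}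
    (h : ∀ a ∈ s, IsWeakDeriv U I (u a) (g a)) :
    IsWeakDeriv U I (∑ a ∈ s, u a) (∑ a ∈ s, g a) := by
  classical
  induction s using Finset.induction_on with
  | empty => simpa using zero
  | insert a s ha ih =>
    rw [Finset.sum_insert ha, Finset.sum_insert ha]
    exact (h a (by simp)).add (ih fun b hb => h b (by simp [hb]))

theorem self {I : Fin 0 → Fin d} (h : MemLp u 2 (volume.restrict U)) : IsWeakDeriv U I u u :=
  ⟨h, h, fun φ _ => by simp [partialDeriv_zero]⟩

/-- The fundamental lemma of the calculus of variations: the difference of the two candidates is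
orthogonal to every test function. -/
theorem ae_unique [CompleteSpace F] (hU : IsOpen U) (h : IsWeakDeriv U I u g)
    (h' : IsWeakDeriv U I u g') : g =ᵐ[volume.restrict U] g' := by
  have hl : LocallyIntegrableOn (g - g') U volume := by
    have := (h.2.1.sub h'.2.1).locallyIntegrable (by norm_num)
    exact locallyIntegrableOn_of_locallyIntegrable_restrict this
  have := hU.ae_eq_zero_of_integral_contDiff_smul_eq_zero hl fun φ h1 h2 h3 => by
    have hφ : IsTest U φ := ⟨h1, h2, h3⟩
    rw [← setIntegral_univ, hφ.setIntegral_of_subset (Set.subset_univ U)]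
    simp only [Pi.sub_apply, smul_sub]
    rw [integral_sub (hφ.integrable_smul h.2.1) (hφ.integrable_smul h'.2.1), sub_eq_zero]
    have := (h.2.2 φ hφ).symm.trans (h'.2.2 φ hφ)
    exact smul_right_injective F (pow_ne_zero j (by norm_num : (-1 : ℝ) ≠ 0)) this
  rw [Filter.EventuallyEq, ae_restrict_iff' hU.measurableSet]
  exact this.mono fun x hx hxU => sub_eq_zero.1 (hx hxU)

/-- If `g = ∂_i u` and `g' = ∂_i ∂_I u`, then `g' = ∂_I g`. -/
theorem of_cons {i : Fin d} (h : IsWeakDeriv U ![i] u g)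
    (h' : IsWeakDeriv U (Matrix.vecCons i I) u g') : IsWeakDeriv U I g g' := by
  refine ⟨h.2.1, h'.2.1, fun φ hφ => ?_⟩
  have h1 := h'.2.2 φ hφ
  rw [partialDeriv_cons hφ.1, h.2.2 _ (hφ.partialDeriv I)] at h1
  rw [pow_succ', pow_succ', pow_zero, mul_one, mul_smul] at h1
  exact smul_right_injective F (by norm_num : (-1 : ℝ) ≠ 0) h1

end IsWeakDeriv

theorem IsTest.isWeakDeriv {φ : Eucl d → F} [CompleteSpace F] (h : IsTest U φ) (i : Fin d) :
    IsWeakDeriv U ![i] φ (fun x => fderiv ℝ φ x (EuclideanSpace.single i 1)) := by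
  refine ⟨h.memLp 2, (h.dirDeriv _).memLp 2, fun ψ hψ => ?_⟩
  have h1 : ∀ (a : Eucl d → ℝ) (b : Eucl d → F), IsTest U a → IsTest U b →
      ∫ x in U, a x • b x = ∫ x, a x • b x := fun a b ha hb =>
    setIntegral_eq_integral_of_forall_compl_eq_zero fun x hx => by simp [ha.zero_of_notMem hx]
  have h2 : ∀ (a : Eucl d → ℝ) (b : Eucl d → F), IsTest U a → IsTest U b →
      Integrable fun x => a x • b x := fun a b ha hb =>
    (ha.1.continuous.smul hb.1.continuous).integrable_of_hasCompactSupport ha.2.1.smul_right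
  rw [h1 _ _ (hψ.partialDeriv _) h, h1 _ _ hψ (h.dirDeriv _),
    integral_smul_fderiv_eq_neg_fderiv_smul_of_integrable]
  · simp [partialDeriv_one]
  · exact h2 _ _ (hψ.dirDeriv _) h
  · exact h2 _ _ hψ (h.dirDeriv _)
  · exact h2 _ _ hψ h
  · exact fun x _ => hψ.differentiable x
  · exact fun x _ => h.differentiable x

end WeakDerivatives

/-! ### Sobolev norms and the chosen weak gradient -/

theorem ENNReal.rpow_half_sq (a : ℝ≥0∞) : (a ^ (1 / 2 : ℝ)) ^ 2 = a := by
  rw [← ENNReal.rpow_natCast, ← ENNReal.rpow_mul]; norm_num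

theorem ENNReal.le_of_sq_le_sq {a b : ℝ≥0∞} (h : a ^ 2 ≤ b ^ 2) : a ≤ b :=
  (ENNReal.pow_le_pow_left_iff two_ne_zero).1 h

section SobolevNorms

variable {d : ℕ} {F : Type} [NormedAddCommGroup F] [NormedSpace ℝ F] {U V Ω : Set (Eucl d)}

theorem IsWeakDeriv.iInf_eLpNorm_eq [CompleteSpace F] (hU : IsOpen U) {j : ℕ} {I : Fin j → Fin d}
    {u g : Eucl d → F} (h : IsWeakDeriv U I u g) :
    (⨅ (g : Eucl d → F) (_ : IsWeakDeriv U I u g), eLpNorm g 2 (volume.restrict U)) =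
      eLpNorm g 2 (volume.restrict U) :=
  le_antisymm (iInf₂_le g h)
    (le_iInf₂ fun _ h' => (eLpNorm_congr_ae (h.ae_unique hU h')).le)

theorem sobolevSeminorm_sq (U : Set (Eucl d)) (j : ℕ) (u : Eucl d → F) :
    sobolevSeminorm U j u ^ 2 = ∑ I : Fin j → Fin d,
      (⨅ (g : Eucl d → F) (_ : IsWeakDeriv U I u g), eLpNorm g 2 (volume.restrict U)) ^ 2 :=
  ENNReal.rpow_half_sq _

theorem sobolevNorm_sq (U : Set (Eucl d)) (m : ℕ) (u : Eucl d → F) :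
    sobolevNorm U m u ^ 2 = ∑ j ∈ Finset.range (m + 1), sobolevSeminorm U j u ^ 2 :=
  ENNReal.rpow_half_sq _

theorem sobolevSeminorm_le_sobolevNorm {j m : ℕ} (hj : j ≤ m) (u : Eucl d → F) :
    sobolevSeminorm U j u ≤ sobolevNorm U m u := by
  apply ENNReal.le_of_sq_le_sq
  rw [sobolevNorm_sq]
  exact Finset.single_le_sum (f := fun j => sobolevSeminorm U j u ^ 2) (fun _ _ => zero_le)
    (Finset.mem_range.2 (by omega))

theorem IsWeakDeriv.eLpNorm_le_sobolevNorm [CompleteSpace F] (hU : IsOpen U) {j m : ℕ}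
    (hj : j ≤ m) {I : Fin j → Fin d} {u g : Eucl d → F} (h : IsWeakDeriv U I u g) :
    eLpNorm g 2 (volume.restrict U) ≤ sobolevNorm U m u := by
  refine le_trans (ENNReal.le_of_sq_le_sq ?_) (sobolevSeminorm_le_sobolevNorm hj u)
  rw [sobolevSeminorm_sq, ← h.iInf_eLpNorm_eq hU]
  exact Finset.single_le_sum (f := fun I : Fin j → Fin d =>
    (⨅ (g : Eucl d → F) (_ : IsWeakDeriv U I u g), eLpNorm g 2 (volume.restrict U)) ^ 2)
    (fun _ _ => zero_le) (Finset.mem_univ I)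

/-- The number of partial derivatives of order at most `m` in `ℝ^d`. -/
def numDerivs (d m : ℕ) : ℕ := ∑ j ∈ Finset.range (m + 1), d ^ j

theorem sobolevNorm_le_of_forall {m : ℕ} {u : Eucl d → F} {B : ℝ≥0∞}
    (h : ∀ j ≤ m, ∀ I : Fin j → Fin d, ∃ g, IsWeakDeriv U I u g ∧
      eLpNorm g 2 (volume.restrict U) ≤ B) :
    sobolevNorm U m u ≤ numDerivs d m * B := by
  apply ENNReal.le_of_sq_le_sq
  have h1 : sobolevNorm U m u ^ 2 ≤ numDerivs d m * B ^ 2 := by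
    rw [sobolevNorm_sq, numDerivs, Nat.cast_sum, Finset.sum_mul]
    refine Finset.sum_le_sum fun j hj => ?_
    rw [sobolevSeminorm_sq]
    calc _ ≤ ∑ _I : Fin j → Fin d, B ^ 2 := by
          refine Finset.sum_le_sum fun I _ => ?_
          obtain ⟨g, hg, hgB⟩ := h j (by simpa [Nat.lt_succ_iff] using hj) I
          gcongr
          exact (iInf₂_le g hg).trans hgB
      _ = _ := by simp
  refine h1.trans ?_
  rw [mul_pow]
  gcongr
  -- Summing squares produces the factor `N`, the claim squared has `N²`; `N ≤ N²` since `N` is a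
  -- natural number.
  have : numDerivs d m ≤ numDerivs d m ^ 2 := Nat.le_self_pow two_ne_zero _
  exact_mod_cast this

namespace MemSobolev

variable {m n : ℕ} {u v : Eucl d → F}

theorem of_le (h : MemSobolev U n u) (hmn : m ≤ n) : MemSobolev U m u :=
  fun j hj I => h j (hj.trans hmn) I

theorem congr (h : MemSobolev U m u) (huv : u =ᵐ[volume.restrict U] v) : MemSobolev U m v :=
  fun j hj I => (h j hj I).imp fun _ hg => hg.congr huv (ae_eq_refl _)

theorem sub (h : MemSobolev U m u) (h' : MemSobolev U m v) : MemSobolev U m (u - v) := by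
  intro j hj I
  obtain ⟨g, hg⟩ := h j hj I
  obtain ⟨g', hg'⟩ := h' j hj I
  exact ⟨_, hg.sub hg'⟩

theorem sobolevNorm_lt_top (h : MemSobolev U m u) : sobolevNorm U m u < ⊤ := by
  refine ENNReal.rpow_lt_top_of_nonneg (by norm_num) (ENNReal.sum_ne_top.2 fun j hj => ?_)
  rw [sobolevSeminorm_sq]
  refine ENNReal.sum_ne_top.2 fun I _ => ?_
  obtain ⟨g, hg⟩ := h j (by simpa [Nat.lt_succ_iff] using hj) I
  exact ENNReal.pow_ne_top ((iInf₂_le g hg).trans_lt hg.2.1.2).ne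

end MemSobolev

theorem memSobolev_one_of_isWeakDeriv {u : Eucl d → F} {g : Fin d → Eucl d → F}
    (hu : MemLp u 2 (volume.restrict U)) (h : ∀ i, IsWeakDeriv U ![i] u (g i)) :
    MemSobolev U 1 u := by
  intro j hj I
  interval_cases j
  · exact ⟨u, .self hu⟩
  · have : I = ![I 0] := by ext l; rw [Subsingleton.elim l 0]; rfl
    exact ⟨g (I 0), this ▸ h (I 0)⟩

theorem IsTest.memSobolev_one [CompleteSpace F] {φ : Eucl d → F} (h : IsTest U φ) :
    MemSobolev U 1 φ :=
  memSobolev_one_of_isWeakDeriv (h.memLp 2) fun i => h.isWeakDeriv i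

/-- By uniqueness the arbitrary choice in `weakPartial` is harmless. Linearity of the gradient rests
on this. -/
theorem IsWeakDeriv.weakPartial_ae_eq [CompleteSpace F] (hΩ : IsOpen Ω) {i : Fin d} {u : L2 Ω F}
    {g : Eucl d → F}
    (h : IsWeakDeriv Ω ![i] u g) : weakPartial Ω i u =ᵐ[volume.restrict Ω] g := by
  have hex : ∃ g : L2 Ω F, IsWeakDeriv Ω ![i] u g :=
    ⟨h.2.1.toLp g, h.congr (ae_eq_refl _) h.2.1.coeFn_toLp.symm⟩
  rw [weakPartial, dif_pos hex]
  exact hex.choose_spec.ae_unique hΩ h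

theorem IsWeakDeriv.weakPartial_eq [CompleteSpace F] (hΩ : IsOpen Ω) {i : Fin d} {u g : L2 Ω F}
    (h : IsWeakDeriv Ω ![i] u g) : weakPartial Ω i u = g :=
  Lp.ext (h.weakPartial_ae_eq hΩ)

theorem MemSobolev.isWeakDeriv_weakPartial {u : L2 Ω F} (h : MemSobolev Ω 1 u) (i : Fin d) :
    IsWeakDeriv Ω ![i] u (weakPartial Ω i u) := by
  obtain ⟨g, hg⟩ := h 1 le_rfl ![i]
  have hex : ∃ g : L2 Ω F, IsWeakDeriv Ω ![i] u g :=
    ⟨hg.2.1.toLp g, hg.congr (ae_eq_refl _) hg.2.1.coeFn_toLp.symm⟩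
  rw [weakPartial, dif_pos hex]
  exact hex.choose_spec

theorem MemSobolev.sub_L2 {m : ℕ} {u v : L2 Ω F} (h : MemSobolev Ω m u)
    (h' : MemSobolev Ω m v) : MemSobolev Ω m ⇑(u - v) :=
  (h.sub h').congr (Lp.coeFn_sub u v).symm

theorem MemSobolev.weakPartial_sub [CompleteSpace F] (hΩ : IsOpen Ω) {u v : L2 Ω F}
    (h : MemSobolev Ω 1 u)
    (h' : MemSobolev Ω 1 v) (i : Fin d) :
    weakPartial Ω i (u - v) = weakPartial Ω i u - weakPartial Ω i v :=
  (((h.isWeakDeriv_weakPartial i).sub (h'.isWeakDeriv_weakPartial i)).congr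
    (Lp.coeFn_sub u v).symm (Lp.coeFn_sub _ _).symm).weakPartial_eq hΩ

theorem MemSobolev.memSobolev_weakPartial {m : ℕ} {u : L2 Ω F} (h : MemSobolev Ω (m + 1) u)
    (i : Fin d) :
    MemSobolev Ω m (weakPartial Ω i u) := by
  intro j hj I
  obtain ⟨g, hg⟩ := h (j + 1) (by omega) (Matrix.vecCons i I)
  exact ⟨g, ((h.of_le (by omega)).isWeakDeriv_weakPartial i).of_cons hg⟩

/-- The norm of the gradient of `u`, for `u` in `H^1(Ω)`. -/
noncomputable def gradNorm (Ω : Set (Eucl d)) (u : L2 Ω F) : ℝ :=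
  √(∑ i, ‖weakPartial Ω i u‖ ^ 2)

theorem gradNorm_nonneg (u : L2 Ω F) : 0 ≤ gradNorm Ω u := Real.sqrt_nonneg _

theorem gradNorm_sq (u : L2 Ω F) : gradNorm Ω u ^ 2 = ∑ i, ‖weakPartial Ω i u‖ ^ 2 :=
  Real.sq_sqrt (Finset.sum_nonneg fun _ _ => sq_nonneg _)

theorem norm_weakPartial_le_gradNorm (u : L2 Ω F) (i : Fin d) :
    ‖weakPartial Ω i u‖ ≤ gradNorm Ω u :=
  Real.le_sqrt_of_sq_le (Finset.single_le_sum (f := fun i => ‖weakPartial Ω i u‖ ^ 2)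
    (fun _ _ => sq_nonneg _) (Finset.mem_univ i))

theorem gradNorm_le_of_forall {u : L2 Ω F} {B : ℝ} (hB : 0 ≤ B)
    (h : ∀ i, ‖weakPartial Ω i u‖ ≤ B) : gradNorm Ω u ≤ d * B := by
  refine Real.sqrt_le_iff.2 ⟨by positivity, ?_⟩
  calc ∑ i, ‖weakPartial Ω i u‖ ^ 2 ≤ ∑ _i : Fin d, B ^ 2 :=
        Finset.sum_le_sum fun i _ => pow_le_pow_left₀ (norm_nonneg _) (h i) 2
    _ = d * B ^ 2 := by simp
    _ ≤ (d * B) ^ 2 := by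
        rw [mul_pow]
        have : (d : ℝ) ≤ (d : ℝ) ^ 2 := by exact_mod_cast Nat.le_self_pow two_ne_zero d
        gcongr

theorem gradNorm_sub_le [CompleteSpace F] (hΩ : IsOpen Ω) {u v : L2 Ω F} (h : MemSobolev Ω 1 u)
    (h' : MemSobolev Ω 1 v) : gradNorm Ω (u - v) ≤ gradNorm Ω u + gradNorm Ω v := by
  refine Real.sqrt_le_iff.2 ⟨add_nonneg (gradNorm_nonneg _) (gradNorm_nonneg _), ?_⟩
  have hcs := Real.sum_mul_le_sqrt_mul_sqrt Finset.univ (fun i => ‖weakPartial Ω i u‖)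
    (fun i => ‖weakPartial Ω i v‖)
  calc ∑ i, ‖weakPartial Ω i (u - v)‖ ^ 2
      ≤ ∑ i, (‖weakPartial Ω i u‖ ^ 2 + ‖weakPartial Ω i v‖ ^ 2 +
          2 * (‖weakPartial Ω i u‖ * ‖weakPartial Ω i v‖)) := by
        refine Finset.sum_le_sum fun i _ => ?_
        rw [h.weakPartial_sub hΩ h' i]
        calc _ ≤ (‖weakPartial Ω i u‖ + ‖weakPartial Ω i v‖) ^ 2 :=
              pow_le_pow_left₀ (norm_nonneg _) (norm_sub_le _ _) 2
          _ = _ := by ring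
    _ = gradNorm Ω u ^ 2 + gradNorm Ω v ^ 2 +
        2 * ∑ i, ‖weakPartial Ω i u‖ * ‖weakPartial Ω i v‖ := by
        rw [Finset.sum_add_distrib, Finset.sum_add_distrib, Finset.mul_sum, gradNorm_sq,
          gradNorm_sq]
    _ ≤ gradNorm Ω u ^ 2 + gradNorm Ω v ^ 2 + 2 * (gradNorm Ω u * gradNorm Ω v) := by
        gcongr; exact hcs
    _ = _ := by ring

theorem Fin.sum_univ_funOne {M : Type*} [AddCommMonoid M] (f : (Fin 1 → Fin d) → M) :
    ∑ I, f I = ∑ i, f ![i] :=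
  Fintype.sum_equiv (Equiv.funUnique (Fin 1) (Fin d)) _ _ fun I => by
    congr 1; ext l; rw [Subsingleton.elim l 0]; rfl

/-- The bridge from infima in `ℝ≥0∞` to the real number `gradNorm`, in which all energy estimates
are carried out. -/
theorem sobolevSeminorm_one_eq [CompleteSpace F] (hΩ : IsOpen Ω) {u : L2 Ω F}
    (h : MemSobolev Ω 1 u) :
    sobolevSeminorm Ω 1 u = ENNReal.ofReal (gradNorm Ω u) := by
  apply (ENNReal.pow_right_strictMono two_ne_zero).injective
  simp only
  rw [sobolevSeminorm_sq, Fin.sum_univ_funOne, ← ENNReal.ofReal_pow (gradNorm_nonneg _),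
    gradNorm_sq, ENNReal.ofReal_sum_of_nonneg fun _ _ => sq_nonneg _]
  refine Finset.sum_congr rfl fun i _ => ?_
  rw [(h.isWeakDeriv_weakPartial i).iInf_eLpNorm_eq hΩ, ENNReal.ofReal_pow (norm_nonneg _),
    ← Lp.enorm_def, ofReal_norm]

theorem sobolevSeminorm_zero_eq [CompleteSpace F] (hΩ : IsOpen Ω) (u : L2 Ω F) :
    sobolevSeminorm Ω 0 u = ENNReal.ofReal ‖u‖ := by
  apply (ENNReal.pow_right_strictMono two_ne_zero).injective
  simp only
  rw [sobolevSeminorm_sq, Fintype.sum_unique,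
    (IsWeakDeriv.self (Lp.memLp u)).iInf_eLpNorm_eq hΩ, ← Lp.enorm_def, ofReal_norm]

theorem sobolevNorm_one_eq [CompleteSpace F] (hΩ : IsOpen Ω) {u : L2 Ω F} (h : MemSobolev Ω 1 u) :
    sobolevNorm Ω 1 u = ENNReal.ofReal √(‖u‖ ^ 2 + gradNorm Ω u ^ 2) := by
  apply (ENNReal.pow_right_strictMono two_ne_zero).injective
  simp only
  rw [sobolevNorm_sq, Finset.sum_range_succ, Finset.sum_range_one, sobolevSeminorm_zero_eq hΩ,
    sobolevSeminorm_one_eq hΩ h, ← ENNReal.ofReal_pow (gradNorm_nonneg _),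
    ← ENNReal.ofReal_pow (norm_nonneg _), ← ENNReal.ofReal_pow (Real.sqrt_nonneg _),
    Real.sq_sqrt (by positivity), ENNReal.ofReal_add (by positivity) (by positivity)]

end SobolevNorms

/-! ### From bounds on the elements to bounds on `Ω` -/

section Cells

theorem eLpNorm_two_sq {α F : Type*} [NormedAddCommGroup F] [MeasurableSpace α] (ν : Measure α)
    (w : α → F) :
    eLpNorm w 2 ν ^ 2 = ∫⁻ x, ‖w x‖ₑ ^ 2 ∂ν := by
  rw [eLpNorm_eq_lintegral_rpow_enorm_toReal two_ne_zero (by simp)]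
  simp only [ENNReal.toReal_ofNat]
  rw [ENNReal.rpow_half_sq]
  simp

namespace MixedDiscretization

variable {d : ℕ} {F : Type} [NormedAddCommGroup F] [NormedSpace ℝ F] {Ω : Set (Eucl d)}

variable (D : MixedDiscretization Ω)

/-- The squared `L²` norm is an integral, hence additive over disjoint cells, and the uncovered
remainder is a null set. -/
theorem sum_eLpNorm_sq {F : Type*} [NormedAddCommGroup F] (w : Eucl d → F) :
    ∑ T ∈ D.cells, eLpNorm w 2 (volume.restrict T) ^ 2 = eLpNorm w 2 (volume.restrict Ω) ^ 2 := by
  simp only [eLpNorm_two_sq]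
  have hae : (Ω : Set (Eucl d)) =ᵐ[volume] ⋃ T ∈ D.cells, T := by
    refine (ae_eq_set.2 ⟨D.cells_cover, ?_⟩)
    rw [Set.sdiff_eq_empty.2 (Set.iUnion₂_subset D.cells_subset), measure_empty]
  rw [Measure.restrict_congr_set hae, lintegral_biUnion_finset]
  · exact fun T hT T' hT' hne => D.cells_disjoint T hT T' hT' hne
  · exact fun T hT => (D.cells_open T hT).measurableSet

theorem eLpNorm_le_of_cells {F : Type*} [NormedAddCommGroup F] (w : Eucl d → F) {a : ℝ≥0∞}
    {S : Set (Eucl d) → ℝ≥0∞} {B : ℝ≥0∞}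
    (hS : ∑ T ∈ D.cells, S T ^ 2 ≤ B ^ 2)
    (h : ∀ T ∈ D.cells, eLpNorm w 2 (volume.restrict T) ≤ a * S T) :
    eLpNorm w 2 (volume.restrict Ω) ≤ a * B := by
  apply ENNReal.le_of_sq_le_sq
  rw [← D.sum_eLpNorm_sq, mul_pow]
  calc _ ≤ ∑ T ∈ D.cells, a ^ 2 * S T ^ 2 :=
        Finset.sum_le_sum fun T hT => by rw [← mul_pow]; gcongr; exact h T hT
    _ = a ^ 2 * ∑ T ∈ D.cells, S T ^ 2 := by rw [Finset.mul_sum]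
    _ ≤ _ := by gcongr

/-- A weak derivative on `Ω` restricts to one on each cell, so it is a competitor in each local
infimum. -/
theorem sum_sobolevSeminorm_sq_le [CompleteSpace F] (hΩ : IsOpen Ω) (j : ℕ) {u : Eucl d → F}
    (h : ∀ I : Fin j → Fin d, ∃ g, IsWeakDeriv Ω I u g) :
    ∑ T ∈ D.cells, sobolevSeminorm T j u ^ 2 ≤ sobolevSeminorm Ω j u ^ 2 := by
  choose g hg using h
  simp only [sobolevSeminorm_sq]
  rw [Finset.sum_comm]
  refine Finset.sum_le_sum fun I _ => ?_
  rw [(hg I).iInf_eLpNorm_eq hΩ, ← D.sum_eLpNorm_sq]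
  refine Finset.sum_le_sum fun T hT => ?_
  gcongr
  exact iInf₂_le _ ((hg I).mono (D.cells_subset T hT))

theorem sum_sobolevNorm_sq_le [CompleteSpace F] (hΩ : IsOpen Ω) {m : ℕ} {u : Eucl d → F}
    (h : MemSobolev Ω m u) :
    ∑ T ∈ D.cells, sobolevNorm T m u ^ 2 ≤ sobolevNorm Ω m u ^ 2 := by
  simp only [sobolevNorm_sq]
  rw [Finset.sum_comm]
  exact Finset.sum_le_sum fun j hj =>
    D.sum_sobolevSeminorm_sq_le hΩ j (h j (by simpa [Nat.lt_succ_iff] using hj))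

theorem diam_le_meshSize {T : Set (Eucl d)} (hT : T ∈ D.cells) :
    Metric.diam T ≤ D.meshSize :=
  le_ciSup (f := fun T : D.cells => Metric.diam (T : Set (Eucl d)))
    (Set.finite_range _).bddAbove ⟨T, hT⟩

theorem meshSize_nonneg : 0 ≤ D.meshSize :=
  Real.iSup_nonneg fun _ => Metric.diam_nonneg

end MixedDiscretization

end Cells

/-! ### The space `H^1_0` as a closed graph -/

theorem Lp.norm_sub_lt_of_eLpNorm_lt {d : ℕ} {Ω : Set (Eucl d)}
    {F : Type} [NormedAddCommGroup F] {f g : L2 Ω F} {f' g' : Eucl d → F}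
    (hf : f =ᵐ[volume.restrict Ω] f') (hg : g =ᵐ[volume.restrict Ω] g') {ε : ℝ}
    (h : eLpNorm (f' - g') 2 (volume.restrict Ω) < ENNReal.ofReal ε) : ‖f - g‖ < ε := by
  rw [← eLpNorm_congr_ae ((Lp.coeFn_sub f g).trans (hf.sub hg))] at h
  rw [Lp.norm_def]
  exact (ENNReal.lt_ofReal_iff_toReal_lt (Lp.eLpNorm_ne_top _)).1 h

section Graph

variable {d : ℕ} {F : Type} [NormedAddCommGroup F] [NormedSpace ℝ F] {U Ω : Set (Eucl d)}

theorem IsTest.add {φ ψ : Eucl d → F} (h : IsTest U φ) (h' : IsTest U ψ) :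
    IsTest U (φ + ψ) :=
  ⟨h.1.add h'.1, h.2.1.add h'.2.1,
    (tsupport_add φ ψ).trans (Set.union_subset h.2.2 h'.2.2)⟩

theorem IsTest.neg {φ : Eucl d → F} (h : IsTest U φ) : IsTest U (-φ) :=
  ⟨h.1.neg, h.2.1.comp_left (g := fun y => -y) neg_zero,
    (tsupport_comp_subset (g := fun y : F => -y) neg_zero φ).trans h.2.2⟩

theorem IsTest.zero : IsTest U (0 : Eucl d → F) :=
  ⟨contDiff_zero_fun, .zero, by simp [tsupport_zero]⟩

/-- The pairs `(φ, ∇φ)` in `L²`, for the test functions `φ`. -/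
def testGraph (Ω : Set (Eucl d)) (F : Type) [NormedAddCommGroup F] [NormedSpace ℝ F] :
     AddSubgroup (L2 Ω F × (Fin d → L2 Ω F)) where
  carrier := {x | ∃ φ : Eucl d → F, IsTest Ω φ ∧ x.1 =ᵐ[volume.restrict Ω] φ ∧
    ∀ i, x.2 i =ᵐ[volume.restrict Ω] fun y => fderiv ℝ φ y (EuclideanSpace.single i 1)}
  add_mem' := by
    rintro x y ⟨φ, hφ, h1, h2⟩ ⟨ψ, hψ, h3, h4⟩
    refine ⟨φ + ψ, hφ.add hψ, (Lp.coeFn_add _ _).trans (h1.add h3), fun i => ?_⟩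
    refine (Lp.coeFn_add _ _).trans (((h2 i).add (h4 i)).trans (.of_forall fun z => ?_))
    change _ = fderiv ℝ (φ + ψ) z _
    rw [fderiv_add (hφ.differentiable z) (hψ.differentiable z)]
    rfl
  zero_mem' := ⟨0, .zero, Lp.coeFn_zero _ _ _, fun i => (Lp.coeFn_zero _ _ _).trans
    (.of_forall fun z => by simp)⟩
  neg_mem' := by
    rintro x ⟨φ, hφ, h1, h2⟩
    refine ⟨-φ, hφ.neg, (Lp.coeFn_neg _).trans h1.neg, fun i => ?_⟩
    refine (Lp.coeFn_neg _).trans ((h2 i).neg.trans (.of_forall fun z => ?_))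
    change _ = fderiv ℝ (-φ) z _
    rw [fderiv_neg]
    rfl

/-- The graph of the gradient on `H^1_0(Ω; F)`. -/
noncomputable def h10Graph (Ω : Set (Eucl d)) (F : Type) [NormedAddCommGroup F] [NormedSpace ℝ F] :
     AddSubgroup (L2 Ω F × (Fin d → L2 Ω F)) :=
  (testGraph Ω F).topologicalClosure

/-- The density principle: a closed condition on a function and its gradient need only be checked on
test functions. -/
theorem h10Graph_subset {S : Set (L2 Ω F × (Fin d → L2 Ω F))} (hS : IsClosed S)
    (h : ∀ φ : Eucl d → F, IsTest Ω φ → ∀ x : L2 Ω F × (Fin d → L2 Ω F),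
      x.1 =ᵐ[volume.restrict Ω] φ →
      (∀ i, x.2 i =ᵐ[volume.restrict Ω] fun y => fderiv ℝ φ y (EuclideanSpace.single i 1)) →
      x ∈ S) {x : L2 Ω F × (Fin d → L2 Ω F)} (hx : x ∈ h10Graph Ω F) : x ∈ S :=
  closure_minimal (s := (testGraph Ω F : Set (L2 Ω F × (Fin d → L2 Ω F))))
    (fun y hy => by obtain ⟨φ, hφ, h1, h2⟩ := hy; exact h φ hφ y h1 h2) hS hx

theorem MemH10.mem_h10Graph [CompleteSpace F] (hΩ : IsOpen Ω) {v : L2 Ω F} (h : MemH10 Ω v) :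
    (v, fun i => weakPartial Ω i v) ∈ h10Graph Ω F := by
  refine Metric.mem_closure_iff.2 fun ε hε => ?_
  obtain ⟨φ, hφ, hlt⟩ := h.2 (ENNReal.ofReal ε) (by simpa using hε)
  have h0 : IsWeakDeriv Ω (Fin.elim0 : Fin 0 → Fin d) (⇑v - φ) (⇑v - φ) :=
    .self ((Lp.memLp v).sub (hφ.memLp 2))
  have h1 := fun i => (h.1.isWeakDeriv_weakPartial i).sub (hφ.isWeakDeriv i)
  have hφ' := fun i => (hφ.dirDeriv (EuclideanSpace.single i 1)).memLp 2
  refine ⟨((hφ.memLp 2).toLp φ, fun i => (hφ' i).toLp _),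
    ⟨φ, hφ, MemLp.coeFn_toLp (hφ.memLp 2), fun i => MemLp.coeFn_toLp (hφ' i)⟩, ?_⟩
  rw [Prod.dist_eq, max_lt_iff, dist_pi_lt_iff hε]
  simp only [dist_eq_norm]
  exact ⟨Lp.norm_sub_lt_of_eLpNorm_lt (ae_eq_refl _) (MemLp.coeFn_toLp (hφ.memLp 2))
      ((h0.eLpNorm_le_sobolevNorm hΩ (by simp)).trans_lt hlt),
    fun i => Lp.norm_sub_lt_of_eLpNorm_lt (ae_eq_refl _) (MemLp.coeFn_toLp (hφ' i))
      (((h1 i).eLpNorm_le_sobolevNorm hΩ le_rfl).trans_lt hlt)⟩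

theorem IsTest.memH10 [CompleteSpace F] {φ : Eucl d → F} (h : IsTest Ω φ) {v : L2 Ω F}
    (hv : v =ᵐ[volume.restrict Ω] φ) : MemH10 Ω v := by
  refine ⟨h.memSobolev_one.congr hv.symm, fun ε hε => ⟨φ, h, ?_⟩⟩
  -- The approximating test function is `φ` itself: the difference vanishes almost everywhere, so
  -- all its weak derivatives may be taken to be `0`.
  refine lt_of_le_of_lt (sobolevNorm_le_of_forall (B := 0) fun j _ I => ⟨0, ?_, by simp⟩)
    (by simpa using hε)
  exact IsWeakDeriv.zero.congr (hv.mono fun x hx => by simp [hx]) (ae_eq_refl _)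

end Graph

/-! ### Components of vector fields and integration by parts in `H^1_0` -/

section Components

variable {d : ℕ} {U Ω : Set (Eucl d)}

/-- The `i`-th component of a vector field. -/
noncomputable def coordL2 (Ω : Set (Eucl d)) (i : Fin d) : L2 Ω (Eucl d) →L[ℝ] L2 Ω ℝ :=
  (EuclideanSpace.proj i : Eucl d →L[ℝ] ℝ).compLpL 2 (volume.restrict Ω)

theorem coordL2_ae (i : Fin d) (v : L2 Ω (Eucl d)) :
    coordL2 Ω i v =ᵐ[volume.restrict Ω] fun x => v x i :=
  ContinuousLinearMap.coeFn_compLpL _ _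

theorem coordL2_ae_of_ae {v : L2 Ω (Eucl d)} {φ : Eucl d → Eucl d}
    (h : v =ᵐ[volume.restrict Ω] φ) (i : Fin d) :
    coordL2 Ω i v =ᵐ[volume.restrict Ω] fun x => φ x i :=
  (coordL2_ae i v).trans (h.mono fun x hx => by simp only [hx])

/-- The vector field with `i`-th component `q` and all others zero. -/
noncomputable def dirL2 (Ω : Set (Eucl d)) (i : Fin d) : L2 Ω ℝ →L[ℝ] L2 Ω (Eucl d) :=
  ((1 : ℝ →L[ℝ] ℝ).smulRight (EuclideanSpace.single i (1 : ℝ))).compLpL 2 (volume.restrict Ω)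

theorem dirL2_ae (i : Fin d) (q : L2 Ω ℝ) :
    dirL2 Ω i q =ᵐ[volume.restrict Ω] fun x => q x • EuclideanSpace.single i (1 : ℝ) :=
  ContinuousLinearMap.coeFn_compLpL _ _

theorem inner_dirL2 (i : Fin d) (q : L2 Ω ℝ) (v : L2 Ω (Eucl d)) :
    inner ℝ (dirL2 Ω i q) v = inner ℝ q (coordL2 Ω i v) := by
  rw [L2.inner_def, L2.inner_def]
  refine integral_congr_ae ?_
  filter_upwards [dirL2_ae i q, coordL2_ae i v] with x h1 h2
  rw [h1, h2, real_inner_smul_left, EuclideanSpace.inner_single_left]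
  simp [mul_comm]

theorem sum_inner_coordL2 (v w : L2 Ω (Eucl d)) :
    ∑ i, inner ℝ (coordL2 Ω i v) (coordL2 Ω i w) = inner ℝ v w := by
  simp only [L2.inner_def]
  rw [← integral_finsetSum _ fun i _ => L2.integrable_inner _ _]
  refine integral_congr_ae ?_
  filter_upwards [ae_all_iff.2 fun i => coordL2_ae i v, ae_all_iff.2 fun i => coordL2_ae i w]
    with x h1 h2
  simp [h1, h2, PiLp.inner_apply]

theorem sum_norm_coordL2_sq (v : L2 Ω (Eucl d)) :
    ∑ i, ‖coordL2 Ω i v‖ ^ 2 = ‖v‖ ^ 2 := by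
  simp only [← real_inner_self_eq_norm_sq, sum_inner_coordL2]

theorem IsWeakDeriv.coord {j : ℕ} {I : Fin j → Fin d} {u g : L2 Ω (Eucl d)}
    (h : IsWeakDeriv Ω I u g) (i : Fin d) : IsWeakDeriv Ω I (coordL2 Ω i u) (coordL2 Ω i g) :=
  (h.clm_comp (EuclideanSpace.proj i : Eucl d →L[ℝ] ℝ)).congr (coordL2_ae i u).symm
    (coordL2_ae i g).symm

theorem IsWeakDeriv.inner_eq {s s' ψ ψ' : L2 Ω ℝ} {i : Fin d} (h : IsWeakDeriv Ω ![i] s s')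
    {φ : Eucl d → ℝ} (hφ : IsTest Ω φ) (h1 : ψ =ᵐ[volume.restrict Ω] φ)
    (h2 : ψ' =ᵐ[volume.restrict Ω] fun y => fderiv ℝ φ y (EuclideanSpace.single i 1)) :
    inner ℝ s ψ' = - inner ℝ s' ψ := by
  rw [L2.inner_def, L2.inner_def]
  have := h.2.2 φ hφ
  simp only [smul_eq_mul, partialDeriv_one, Nat.succ_eq_add_one, zero_add, pow_one,
    neg_one_mul] at this
  refine Eq.trans (integral_congr_ae ?_) (this.trans (congrArg _ (integral_congr_ae ?_)))
  · filter_upwards [h2] with x hx; simp [hx]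
  · filter_upwards [h1] with x hx; simp [hx]

theorem coordL2_fderiv_ae {v : L2 Ω (Eucl d)} {φ : Eucl d → Eucl d} (hφ : IsTest Ω φ)
    {e : Eucl d} (h : v =ᵐ[volume.restrict Ω] fun y => fderiv ℝ φ y e) (i : Fin d) :
    coordL2 Ω i v =ᵐ[volume.restrict Ω] fun y => fderiv ℝ (fun z => φ z i) y e := by
  refine (coordL2_ae_of_ae h i).trans (.of_forall fun y => ?_)
  have := ((EuclideanSpace.proj i : Eucl d →L[ℝ] ℝ).hasFDerivAt.comp y
    (hφ.differentiable y).hasFDerivAt).fderiv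
  change _ = fderiv ℝ ((EuclideanSpace.proj i : Eucl d →L[ℝ] ℝ) ∘ φ) y e
  rw [this]
  rfl

theorem IsTest.coord {φ : Eucl d → Eucl d} (h : IsTest U φ) (i : Fin d) :
    IsTest U fun x => φ x i :=
  h.clm_comp (EuclideanSpace.proj i : Eucl d →L[ℝ] ℝ)

/-- Integration by parts against a function in `H^1_0`. -/
theorem IsWeakDeriv.inner_coordL2_eq {s s' : L2 Ω ℝ} {j : Fin d} (h : IsWeakDeriv Ω ![j] s s')
    (i : Fin d) {x : L2 Ω (Eucl d) × (Fin d → L2 Ω (Eucl d))} (hx : x ∈ h10Graph Ω (Eucl d)) :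
    inner ℝ s (coordL2 Ω i (x.2 j)) = - inner ℝ s' (coordL2 Ω i x.1) := by
  refine h10Graph_subset (S := {x | inner ℝ s (coordL2 Ω i (x.2 j)) =
    - inner ℝ s' (coordL2 Ω i x.1)}) (isClosed_eq (by fun_prop) (by fun_prop)) ?_ hx
  intro φ hφ x h1 h2
  exact h.inner_eq (hφ.coord i) (coordL2_ae_of_ae h1 i) (coordL2_fderiv_ae hφ (h2 j) i)

/-- The integral of a derivative of a compactly supported function vanishes. This makes the
constants `b`-orthogonal to `H^1_0`. -/
theorem inner_one_coordL2 {r : L2 Ω ℝ} (hr : r =ᵐ[volume.restrict Ω] fun _ => (1 : ℝ))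
    (i j : Fin d) {x : L2 Ω (Eucl d) × (Fin d → L2 Ω (Eucl d))} (hx : x ∈ h10Graph Ω (Eucl d)) :
    inner ℝ r (coordL2 Ω i (x.2 j)) = 0 := by
  refine h10Graph_subset (S := {x | inner ℝ r (coordL2 Ω i (x.2 j)) = 0})
    (isClosed_eq (by fun_prop) (by fun_prop)) ?_ hx
  intro φ hφ x h1 h2
  change inner ℝ r (coordL2 Ω i (x.2 j)) = 0
  have ht := (hφ.coord i).dirDeriv (EuclideanSpace.single j 1)
  rw [L2.inner_def, ← (hφ.coord i).integral_fderiv (EuclideanSpace.single j 1)]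
  rw [← setIntegral_eq_integral_of_forall_compl_eq_zero fun y hy => ht.zero_of_notMem hy]
  refine integral_congr_ae ?_
  filter_upwards [hr, coordL2_fderiv_ae hφ (h2 j) i] with y h3 h4
  simp [h3, h4]

/-- The scalar product of `∂_i v_j` and `∂_j v_i` is that of `∂_i v_i` and `∂_j v_j`, for `v` in
`H^1_0`. -/
theorem inner_coordL2_swap (i j : Fin d) {x : L2 Ω (Eucl d) × (Fin d → L2 Ω (Eucl d))}
    (hx : x ∈ h10Graph Ω (Eucl d)) :
    inner ℝ (coordL2 Ω j (x.2 i)) (coordL2 Ω i (x.2 j)) =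
      inner ℝ (coordL2 Ω i (x.2 i)) (coordL2 Ω j (x.2 j)) := by
  refine h10Graph_subset (S := {x | inner ℝ (coordL2 Ω j (x.2 i)) (coordL2 Ω i (x.2 j)) =
      inner ℝ (coordL2 Ω i (x.2 i)) (coordL2 Ω j (x.2 j))})
    (isClosed_eq (by fun_prop) (by fun_prop)) ?_ hx
  intro φ hφ x h1 h2
  have key : ∀ a b l m : Fin d, inner ℝ (coordL2 Ω a (x.2 l)) (coordL2 Ω b (x.2 m)) =
      ∫ y, fderiv ℝ (fun z => φ z a) y (EuclideanSpace.single l 1) *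
        fderiv ℝ (fun z => φ z b) y (EuclideanSpace.single m 1) := by
    intro a b l m
    rw [← ((hφ.coord a).dirDeriv _).setIntegral_mul, L2.inner_def]
    refine integral_congr_ae ?_
    filter_upwards [coordL2_fderiv_ae hφ (h2 l) a, coordL2_fderiv_ae hφ (h2 m) b] with y h3 h4
    simp [h3, h4, mul_comm]
  change inner ℝ (coordL2 Ω j (x.2 i)) (coordL2 Ω i (x.2 j)) =
      inner ℝ (coordL2 Ω i (x.2 i)) (coordL2 Ω j (x.2 j))
  -- On both sides the derivative is moved off `φ_j`. The results differ only in the order of the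
  -- second derivatives of `φ_i`.
  rw [real_inner_comm _ (coordL2 Ω i (x.2 i)), key, key,
    (hφ.coord j).integral_fderiv_mul ((hφ.coord i).dirDeriv _).1,
    (hφ.coord j).integral_fderiv_mul ((hφ.coord i).dirDeriv _).1]
  congr 2
  ext y
  congr 1
  have hc := (hφ.coord i).1
  have hd : DifferentiableAt ℝ (fderiv ℝ fun z => φ z i) y :=
    (hc.fderiv_right (m := ∞) (by norm_cast)).differentiable (by simp) y
  rw [fderiv_clm_apply hd (differentiableAt_const _),
    fderiv_clm_apply hd (differentiableAt_const _)]
  have hs : IsSymmSndFDerivAt ℝ (fun z => φ z i) y :=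
    hc.contDiffAt.isSymmSndFDerivAt (by simpa using ENat.LEInfty.out)
  simpa using hs _ _

end Components

/-! ### Poincaré's inequality -/

section Poincare

variable {d : ℕ} {Ω : Set (Eucl d)}

/-- The Poincaré inequality for scalar test functions. -/
theorem IsTest.norm_le {φ : Eucl d → ℝ} (h : IsTest Ω φ) (hΩ : MeasurableSet Ω) {R : ℝ}
    (hR : ∀ x ∈ Ω, ‖x‖ ≤ R) (i : Fin d) {ψ ψ' : L2 Ω ℝ} (h1 : ψ =ᵐ[volume.restrict Ω] φ)
    (h2 : ψ' =ᵐ[volume.restrict Ω] fun y => fderiv ℝ φ y (EuclideanSpace.single i 1)) :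
    ‖ψ‖ ≤ 2 * R * ‖ψ'‖ := by
  set e : Eucl d := EuclideanSpace.single i 1
  have hx : ContDiff ℝ ∞ fun y : Eucl d => y i :=
    (EuclideanSpace.proj i : Eucl d →L[ℝ] ℝ).contDiff
  -- Integrating `∂_i φ` by parts against `φ x_i` gives `‖φ‖² = -2 ∫ x_i φ ∂_i φ`, because `∂_i x_i
  -- = 1`. Cauchy–Schwarz and `|x_i| ≤ R` on `Ω` yield the constant `2R`.
  have hχ : IsTest Ω fun y => φ y * y i :=
    ⟨h.1.mul hx, h.2.1.mul_right, (tsupport_mul_subset_left).trans h.2.2⟩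
  have hd : ∀ y, fderiv ℝ (fun y => φ y * y i) y e = φ y + fderiv ℝ φ y e * y i := by
    intro y
    have hp : HasFDerivAt (fun y : Eucl d => y i) (EuclideanSpace.proj i : Eucl d →L[ℝ] ℝ) y :=
      (EuclideanSpace.proj i : Eucl d →L[ℝ] ℝ).hasFDerivAt
    change fderiv ℝ (φ * fun y : Eucl d => y i) y e = _
    rw [((h.differentiable y).hasFDerivAt.mul hp).fderiv]
    simp [e, mul_comm]
  have hint : ∀ a b : Eucl d → ℝ, IsTest Ω a → IsTest Ω b → Integrable fun y => a y * b y :=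
    fun a b ha hb =>
      (ha.1.continuous.mul hb.1.continuous).integrable_of_hasCompactSupport ha.2.1.mul_right
  have hparts := h.integral_fderiv_mul hχ.1 e
  simp only [hd, mul_add] at hparts
  have he : ∀ y, φ y * (fderiv ℝ φ y e * y i) = fderiv ℝ φ y e * (φ y * y i) := fun y => by ring
  simp only [he] at hparts
  rw [integral_add (hint _ _ h h) (hint _ _ (h.dirDeriv e) hχ)] at hparts
  obtain ⟨χ, hχL⟩ : ∃ χ : L2 Ω ℝ, χ =ᵐ[volume.restrict Ω] fun y => φ y * y i :=
    ⟨(hχ.memLp 2).toLp _, MemLp.coeFn_toLp _⟩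
  have hψ : ‖ψ‖ ^ 2 = ∫ y, φ y * φ y := by
    rw [← real_inner_self_eq_norm_sq, L2.inner_def, ← h.setIntegral_mul]
    refine integral_congr_ae ?_
    filter_upwards [h1] with y hy
    simp [hy, sq]
  have hin : inner ℝ ψ' χ = ∫ y, fderiv ℝ φ y e * (φ y * y i) := by
    rw [L2.inner_def, ← (h.dirDeriv e).setIntegral_mul]
    refine integral_congr_ae ?_
    filter_upwards [h2, hχL] with y hy hy'
    simp [hy, hy', mul_comm]
  have hχn : ‖χ‖ ≤ R * ‖ψ‖ := by
    refine Lp.norm_le_mul_norm_of_ae_le_mul ?_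
    filter_upwards [hχL, h1, ae_restrict_mem hΩ] with y hy hy' hyΩ
    rw [hy, hy', norm_mul, mul_comm]
    gcongr
    exact (PiLp.norm_apply_le y i).trans (hR y hyΩ)
  have hcs := neg_le_of_abs_le (abs_real_inner_le_norm ψ' χ)
  have h3 : ‖ψ‖ * ‖ψ‖ ≤ (2 * R * ‖ψ'‖) * ‖ψ‖ := by
    have := mul_le_mul_of_nonneg_left hχn (norm_nonneg ψ')
    nlinarith
  -- One factor `‖ψ‖` is to be cancelled. If it is zero, the right side must be shown nonnegative:
  -- `R ≥ 0` follows from any point of `Ω`, and for empty `Ω` both sides vanish.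
  rcases (norm_nonneg ψ).eq_or_lt with h0 | h0
  · rw [← h0] at hχn ⊢
    rcases Ω.eq_empty_or_nonempty with rfl | ⟨y, hy⟩
    · have : ψ' = 0 := Lp.ext (by simp [Filter.EventuallyEq])
      simp [this]
    · have := (norm_nonneg y).trans (hR y hy)
      positivity
  · exact le_of_mul_le_mul_right h3 h0

/-- The Poincaré inequality in `H^1_0`. -/
theorem h10Graph_norm_le (hΩ : MeasurableSet Ω) {R : ℝ} (hR0 : 0 ≤ R) (hR : ∀ x ∈ Ω, ‖x‖ ≤ R)
    (i : Fin d) {x : L2 Ω (Eucl d) × (Fin d → L2 Ω (Eucl d))} (hx : x ∈ h10Graph Ω (Eucl d)) :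
    ‖x.1‖ ≤ 2 * R * ‖x.2 i‖ := by
  have key : ∀ j, ‖coordL2 Ω j x.1‖ ≤ 2 * R * ‖coordL2 Ω j (x.2 i)‖ := by
    intro j
    refine h10Graph_subset (S := {x | ‖coordL2 Ω j x.1‖ ≤ 2 * R * ‖coordL2 Ω j (x.2 i)‖})
      (isClosed_le (by fun_prop) (by fun_prop)) ?_ hx
    intro φ hφ x h1 h2
    exact (hφ.coord j).norm_le hΩ hR i (coordL2_ae_of_ae h1 j) (coordL2_fderiv_ae hφ (h2 i) j)
  refine le_of_sq_le_sq ?_ (by positivity)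
  rw [mul_pow, ← sum_norm_coordL2_sq, ← sum_norm_coordL2_sq, Finset.mul_sum]
  refine Finset.sum_le_sum fun j _ => ?_
  rw [← mul_pow]
  exact pow_le_pow_left₀ (norm_nonneg _) (key j) 2

end Poincare

/-! ### The bilinear forms, Korn's inequality and continuity -/

section Forms

variable {d : ℕ} {Ω : Set (Eucl d)}

/-- `v` lies in `H^1_0(Ω; ℝ^d)`, expressed by the graph of the gradient. -/
def InH10 (Ω : Set (Eucl d)) (v : L2 Ω (Eucl d)) : Prop :=
  MemSobolev Ω 1 v ∧ (v, fun i => weakPartial Ω i v) ∈ h10Graph Ω (Eucl d)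

theorem MemH10.inH10 (hΩ : IsOpen Ω) {v : L2 Ω (Eucl d)} (h : MemH10 Ω v) : InH10 Ω v :=
  ⟨h.1, h.mem_h10Graph hΩ⟩

theorem InH10.sub (hΩ : IsOpen Ω) {v w : L2 Ω (Eucl d)} (h : InH10 Ω v) (h' : InH10 Ω w) :
    InH10 Ω (v - w) := by
  refine ⟨h.1.sub_L2 h'.1, ?_⟩
  have := sub_mem h.2 h'.2
  simp only [h.1.weakPartial_sub hΩ h'.1]
  exact this

/-- The symmetric gradient as an element of a Hilbert space. -/
noncomputable def strainL2 (Ω : Set (Eucl d)) (u : L2 Ω (Eucl d)) :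
    PiLp 2 fun _ : Fin d × Fin d => L2 Ω ℝ :=
  WithLp.toLp 2 fun ij => (2⁻¹ : ℝ) •
    (coordL2 Ω ij.1 (weakPartial Ω ij.2 u) + coordL2 Ω ij.2 (weakPartial Ω ij.1 u))

theorem strainL2_ae (u : L2 Ω (Eucl d)) (i j : Fin d) :
    strainL2 Ω u (i, j) =ᵐ[volume.restrict Ω] fun x => strain Ω u x i j := by
  refine (Lp.coeFn_smul _ _).trans ?_
  filter_upwards [Lp.coeFn_add (coordL2 Ω i (weakPartial Ω j u))
    (coordL2 Ω j (weakPartial Ω i u)), coordL2_ae i (weakPartial Ω j u),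
    coordL2_ae j (weakPartial Ω i u)] with x h1 h2 h3
  simp only [Pi.smul_apply, h1, Pi.add_apply, h2, h3, strain, Matrix.of_apply, smul_eq_mul]
  ring

/-- With `a` written as a Hilbert space inner product, bilinearity and Cauchy–Schwarz come for free.
-/
theorem formA_eq (μ : ℝ) (u v : L2 Ω (Eucl d)) :
    formA Ω μ u v = 2 * μ * inner ℝ (strainL2 Ω u) (strainL2 Ω v) := by
  have hae : ∀ i j : Fin d, (fun x => inner ℝ (strainL2 Ω u (i, j) x) (strainL2 Ω v (i, j) x))
      =ᵐ[volume.restrict Ω] fun x => strain Ω u x i j * strain Ω v x i j := by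
    intro i j
    filter_upwards [strainL2_ae u i j, strainL2_ae v i j] with x h1 h2
    simp [h1, h2, mul_comm]
  have hint : ∀ i j : Fin d, Integrable (fun x => strain Ω u x i j * strain Ω v x i j)
      (volume.restrict Ω) := fun i j => (L2.integrable_inner (𝕜 := ℝ) _ _).congr (hae i j)
  rw [formA, PiLp.inner_apply, Fintype.sum_prod_type,
    integral_finsetSum _ fun i _ => integrable_finsetSum _ fun j _ => hint i j]
  congr 1
  refine Finset.sum_congr rfl fun i _ => ?_
  rw [integral_finsetSum _ fun j _ => hint i j]
  refine Finset.sum_congr rfl fun j _ => ?_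
  rw [L2.inner_def, integral_congr_ae (hae i j)]

theorem strainL2_sub (hΩ : IsOpen Ω) {u v : L2 Ω (Eucl d)} (h : MemSobolev Ω 1 u)
    (h' : MemSobolev Ω 1 v) : strainL2 Ω (u - v) = strainL2 Ω u - strainL2 Ω v := by
  ext1 ij
  simp only [strainL2, h.weakPartial_sub hΩ h', map_sub, PiLp.sub_apply, ← smul_sub]
  congr 1
  abel

theorem sum_norm_coordL2_weakPartial_sq (v : L2 Ω (Eucl d)) :
    ∑ i, ∑ j, ‖coordL2 Ω i (weakPartial Ω j v)‖ ^ 2 = gradNorm Ω v ^ 2 := by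
  rw [Finset.sum_comm, gradNorm_sq]
  exact Finset.sum_congr rfl fun j _ => sum_norm_coordL2_sq _

/-- Expansion of the square of `(∂_j v_i + ∂_i v_j)/2`. Only the cross term needs an argument:
Cauchy–Schwarz for the upper bound, its sign on `H^1_0` for Korn's inequality. -/
theorem norm_strainL2_sq (v : L2 Ω (Eucl d)) :
    ‖strainL2 Ω v‖ ^ 2 = 2⁻¹ * (gradNorm Ω v ^ 2 + ∑ i, ∑ j,
      inner ℝ (coordL2 Ω i (weakPartial Ω j v)) (coordL2 Ω j (weakPartial Ω i v))) := by
  have h1 : ‖strainL2 Ω v‖ ^ 2 = ∑ i, ∑ j, 4⁻¹ * (‖coordL2 Ω i (weakPartial Ω j v)‖ ^ 2 +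
      ‖coordL2 Ω j (weakPartial Ω i v)‖ ^ 2 +
      2 * inner ℝ (coordL2 Ω i (weakPartial Ω j v)) (coordL2 Ω j (weakPartial Ω i v))) := by
    rw [PiLp.norm_sq_eq_of_L2, Fintype.sum_prod_type]
    refine Finset.sum_congr rfl fun i _ => Finset.sum_congr rfl fun j _ => ?_
    simp only [strainL2, norm_smul, mul_pow, norm_add_sq_real]
    norm_num
    ring
  rw [h1]
  simp only [← Finset.mul_sum, Finset.sum_add_distrib]
  rw [sum_norm_coordL2_weakPartial_sq, Finset.sum_comm (f := fun i j =>
    ‖coordL2 Ω j (weakPartial Ω i v)‖ ^ 2), sum_norm_coordL2_weakPartial_sq]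
  ring

theorem norm_strainL2_le (v : L2 Ω (Eucl d)) : ‖strainL2 Ω v‖ ≤ gradNorm Ω v := by
  refine le_of_sq_le_sq ?_ (gradNorm_nonneg _)
  have h : ∑ i, ∑ j, inner ℝ (coordL2 Ω i (weakPartial Ω j v)) (coordL2 Ω j (weakPartial Ω i v))
      ≤ ∑ i, ∑ j, 2⁻¹ * (‖coordL2 Ω i (weakPartial Ω j v)‖ ^ 2 +
        ‖coordL2 Ω j (weakPartial Ω i v)‖ ^ 2) := by
    refine Finset.sum_le_sum fun i _ => Finset.sum_le_sum fun j _ => ?_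
    refine (real_inner_le_norm _ _).trans ?_
    linarith [two_mul_le_add_sq ‖coordL2 Ω i (weakPartial Ω j v)‖
      ‖coordL2 Ω j (weakPartial Ω i v)‖]
  simp only [← Finset.mul_sum, Finset.sum_add_distrib] at h
  rw [sum_norm_coordL2_weakPartial_sq, Finset.sum_comm (f := fun i j =>
    ‖coordL2 Ω j (weakPartial Ω i v)‖ ^ 2), sum_norm_coordL2_weakPartial_sq] at h
  rw [norm_strainL2_sq]
  linarith

/-- Korn's first inequality in `H^1_0`. -/
theorem InH10.gradNorm_sq_le {v : L2 Ω (Eucl d)} (h : InH10 Ω v) :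
    gradNorm Ω v ^ 2 ≤ 2 * ‖strainL2 Ω v‖ ^ 2 := by
  -- Swapping the two derivatives turns the cross term into `‖div v‖²`, which is nonnegative and can
  -- be dropped.
  have h1 : ∑ i, ∑ j, inner ℝ (coordL2 Ω i (weakPartial Ω j v))
      (coordL2 Ω j (weakPartial Ω i v)) = ‖∑ i, coordL2 Ω i (weakPartial Ω i v)‖ ^ 2 := by
    rw [← real_inner_self_eq_norm_sq, sum_inner]
    refine Finset.sum_congr rfl fun i _ => ?_
    rw [inner_sum]
    refine Finset.sum_congr rfl fun j _ => ?_
    rw [real_inner_comm]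
    exact inner_coordL2_swap i j h.2
  rw [norm_strainL2_sq, h1]
  nlinarith [sq_nonneg ‖∑ i, coordL2 Ω i (weakPartial Ω i v)‖]

theorem InH10.le_formA {μ : ℝ} (hμ : 0 < μ) {v : L2 Ω (Eucl d)} (h : InH10 Ω v) :
    μ * gradNorm Ω v ^ 2 ≤ formA Ω μ v v := by
  rw [formA_eq, real_inner_self_eq_norm_sq]
  nlinarith [h.gradNorm_sq_le]

theorem abs_formA_le {μ : ℝ} (hμ : 0 < μ) (u v : L2 Ω (Eucl d)) :
    |formA Ω μ u v| ≤ 2 * μ * (gradNorm Ω u * gradNorm Ω v) := by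
  rw [formA_eq, abs_mul, abs_of_pos (by positivity)]
  gcongr
  exact (abs_real_inner_le_norm _ _).trans (mul_le_mul (norm_strainL2_le u) (norm_strainL2_le v)
    (norm_nonneg _) (gradNorm_nonneg _))

theorem formA_sub_left (hΩ : IsOpen Ω) (μ : ℝ) {u v : L2 Ω (Eucl d)} (h : MemSobolev Ω 1 u)
    (h' : MemSobolev Ω 1 v) (w : L2 Ω (Eucl d)) :
    formA Ω μ (u - v) w = formA Ω μ u w - formA Ω μ v w := by
  simp only [formA_eq, strainL2_sub hΩ h h', inner_sub_left, mul_sub]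

theorem formA_sub_right (hΩ : IsOpen Ω) (μ : ℝ) {u v : L2 Ω (Eucl d)} (h : MemSobolev Ω 1 u)
    (h' : MemSobolev Ω 1 v) (w : L2 Ω (Eucl d)) :
    formA Ω μ w (u - v) = formA Ω μ w u - formA Ω μ w v := by
  simp only [formA_eq, strainL2_sub hΩ h h', inner_sub_right, mul_sub]

theorem L2.eq_of_forall_isTest {F : Type} [NormedAddCommGroup F] [NormedSpace ℝ F]
    [CompleteSpace F] (hΩ : IsOpen Ω) {g g' : L2 Ω F}
    (h : ∀ φ : Eucl d → ℝ, IsTest Ω φ → ∫ x in Ω, φ x • g x = ∫ x in Ω, φ x • g' x) : g = g' := by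
  -- Both functions are weak derivatives of order zero of `g`, so uniqueness applies.
  have h1 : IsWeakDeriv Ω (Fin.elim0 : Fin 0 → Fin d) g g := .self (Lp.memLp g)
  have h2 : IsWeakDeriv Ω (Fin.elim0 : Fin 0 → Fin d) g g' :=
    ⟨Lp.memLp g, Lp.memLp g', fun φ hφ => by simpa [partialDeriv_zero] using h φ hφ⟩
  exact Lp.ext (h1.ae_unique hΩ h2)

theorem MemSobolev.isWeakDiv {v : L2 Ω (Eucl d)} (h : MemSobolev Ω 1 v) :
    IsWeakDiv Ω v (∑ i, coordL2 Ω i (weakPartial Ω i v)) := by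
  intro φ hφ
  have hw := fun i => (h.isWeakDeriv_weakPartial i).coord i
  have h1 : ∫ x in Ω, ∑ i, v x i * partialDeriv ![i] φ x =
      ∫ x in Ω, ∑ i, partialDeriv ![i] φ x • coordL2 Ω i v x := by
    refine integral_congr_ae ?_
    filter_upwards [ae_all_iff.2 fun i => coordL2_ae i v] with x hx
    simp [hx, mul_comm]
  have h2 : ∫ x in Ω, (∑ i, coordL2 Ω i (weakPartial Ω i v) : L2 Ω ℝ) x * φ x =
      ∫ x in Ω, ∑ i, φ x • coordL2 Ω i (weakPartial Ω i v) x := by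
    refine integral_congr_ae ?_
    filter_upwards [Lp.coeFn_fun_finsetSum Finset.univ
      fun i => coordL2 Ω i (weakPartial Ω i v)] with x hx
    rw [hx, Finset.sum_mul]
    simp [mul_comm]
  rw [h1, h2, integral_finsetSum _ fun i _ => (hφ.partialDeriv _).integrable_smul (hw i).1,
    integral_finsetSum _ fun i _ => hφ.integrable_smul (hw i).2.1, ← Finset.sum_neg_distrib]
  refine Finset.sum_congr rfl fun i _ => ?_
  rw [(hw i).2.2 φ hφ]
  simp

theorem IsWeakDiv.weakDiv_eq (hΩ : IsOpen Ω) {v : L2 Ω (Eucl d)} {g : L2 Ω ℝ}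
    (h : IsWeakDiv Ω v g) : weakDiv Ω v = g := by
  have hex : MemHdiv Ω v := ⟨g, h⟩
  rw [weakDiv, dif_pos hex]
  refine L2.eq_of_forall_isTest hΩ fun φ hφ => ?_
  have := (hex.choose_spec φ hφ).symm.trans (h φ hφ)
  simpa [mul_comm] using this

theorem formB_eq (hΩ : IsOpen Ω) (q : L2 Ω ℝ) {v : L2 Ω (Eucl d)} (h : MemSobolev Ω 1 v) :
    formB Ω q v = ∑ i, inner ℝ q (coordL2 Ω i (weakPartial Ω i v)) := by
  rw [formB, h.isWeakDiv.weakDiv_eq hΩ]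
  exact inner_sum _ _ _

theorem formB_sub_right (hΩ : IsOpen Ω) (q : L2 Ω ℝ) {v w : L2 Ω (Eucl d)}
    (h : MemSobolev Ω 1 v) (h' : MemSobolev Ω 1 w) :
    formB Ω q (v - w) = formB Ω q v - formB Ω q w := by
  rw [formB_eq hΩ q (h.sub_L2 h'), formB_eq hΩ q h, formB_eq hΩ q h', ← Finset.sum_sub_distrib]
  simp only [h.weakPartial_sub hΩ h', map_sub, inner_sub_right]

theorem formB_sub_left (q r : L2 Ω ℝ) (v : L2 Ω (Eucl d)) :
    formB Ω (q - r) v = formB Ω q v - formB Ω r v := inner_sub_left _ _ _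

theorem norm_coordL2_le (i : Fin d) (v : L2 Ω (Eucl d)) : ‖coordL2 Ω i v‖ ≤ ‖v‖ := by
  refine le_of_sq_le_sq ?_ (norm_nonneg _)
  rw [← sum_norm_coordL2_sq v]
  exact Finset.single_le_sum (f := fun i => ‖coordL2 Ω i v‖ ^ 2) (fun _ _ => sq_nonneg _)
    (Finset.mem_univ i)

theorem abs_formB_le (hΩ : IsOpen Ω) (q : L2 Ω ℝ) {v : L2 Ω (Eucl d)} (h : MemSobolev Ω 1 v) :
    |formB Ω q v| ≤ d * (‖q‖ * gradNorm Ω v) := by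
  rw [formB_eq hΩ q h]
  calc _ ≤ ∑ i, |inner ℝ q (coordL2 Ω i (weakPartial Ω i v))| := Finset.abs_sum_le_sum_abs _ _
    _ ≤ ∑ _i : Fin d, ‖q‖ * gradNorm Ω v := by
        refine Finset.sum_le_sum fun i _ => (abs_real_inner_le_norm _ _).trans ?_
        gcongr
        exact (norm_coordL2_le _ _).trans (norm_weakPartial_le_gradNorm v i)
    _ = _ := by simp

theorem InH10.formB_one (hΩ : IsOpen Ω) {v : L2 Ω (Eucl d)} (h : InH10 Ω v) {r : L2 Ω ℝ}
    (hr : r =ᵐ[volume.restrict Ω] fun _ => (1 : ℝ)) : formB Ω r v = 0 := by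
  rw [formB_eq hΩ r h.1]
  exact Finset.sum_eq_zero fun i _ => inner_one_coordL2 hr i i h.2

end Forms

/-! ### The strong form of the equation and the regularity of `div ε(u)` -/

section StrongForm

variable {d : ℕ} {Ω : Set (Eucl d)}

/-- The gradient of `p` as an element of `L²(Ω; ℝ^d)`. -/
noncomputable def gradL2 (Ω : Set (Eucl d)) (p : L2 Ω ℝ) : L2 Ω (Eucl d) :=
  ∑ i, dirL2 Ω i (weakPartial Ω i p)

theorem inner_gradL2 (p : L2 Ω ℝ) (v : L2 Ω (Eucl d)) :
    inner ℝ (gradL2 Ω p) v = ∑ i, inner ℝ (weakPartial Ω i p) (coordL2 Ω i v) := by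
  simp only [gradL2, sum_inner, inner_dirL2]

theorem InH10.formB_eq_neg_inner_gradL2 (hΩ : IsOpen Ω) {v : L2 Ω (Eucl d)} (h : InH10 Ω v)
    {p : L2 Ω ℝ} (hp : MemSobolev Ω 1 p) : formB Ω p v = - inner ℝ (gradL2 Ω p) v := by
  rw [formB_eq hΩ p h.1, inner_gradL2, ← Finset.sum_neg_distrib]
  exact Finset.sum_congr rfl fun i _ => (hp.isWeakDeriv_weakPartial i).inner_coordL2_eq i h.2

/-- The counterpart of the preceding formula for `π^div v`, for which membership in `H^1_0` is not
available: zero normal trace suffices for a gradient. -/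
theorem HasZeroNormalTrace.inner_gradL2_eq {w : L2 Ω (Eucl d)} (h : HasZeroNormalTrace Ω w)
    {p : L2 Ω ℝ} (hp : MemSobolev Ω 1 p) :
    inner ℝ (gradL2 Ω p) w = - inner ℝ p (weakDiv Ω w) := by
  have h1 := h p hp
  have h2 : ∫ x in Ω, ∑ i, w x i * weakPartial Ω i p x = inner ℝ (gradL2 Ω p) w := by
    rw [inner_gradL2]
    simp only [L2.inner_def]
    rw [← integral_finsetSum _ fun i _ => L2.integrable_inner _ _]
    refine integral_congr_ae ?_
    filter_upwards [ae_all_iff.2 fun i => coordL2_ae i w] with x hx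
    simp [hx]
  rw [h2, real_inner_comm p] at h1
  linarith

/-- The divergence of the symmetric gradient of `u` as an element of `L²(Ω; ℝ^d)`. -/
noncomputable def divStrainL2 (Ω : Set (Eucl d)) (u : L2 Ω (Eucl d)) : L2 Ω (Eucl d) :=
  ∑ i, ∑ j, dirL2 Ω i ((2⁻¹ : ℝ) • (coordL2 Ω i (weakPartial Ω j (weakPartial Ω j u)) +
    coordL2 Ω j (weakPartial Ω j (weakPartial Ω i u))))

theorem MemSobolev.isWeakDeriv_strainL2 {u : L2 Ω (Eucl d)} (hu : MemSobolev Ω 2 u)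
    (i j : Fin d) :
    IsWeakDeriv Ω ![j] (strainL2 Ω u (i, j))
      ((2⁻¹ : ℝ) • (coordL2 Ω i (weakPartial Ω j (weakPartial Ω j u)) +
        coordL2 Ω j (weakPartial Ω j (weakPartial Ω i u))) : L2 Ω ℝ) := by
  have h1 := ((hu.memSobolev_weakPartial j).isWeakDeriv_weakPartial j).coord i
  have h2 := ((hu.memSobolev_weakPartial i).isWeakDeriv_weakPartial j).coord j
  have key : ∀ a b : L2 Ω ℝ, (2⁻¹ : ℝ) • (⇑a + ⇑b) =ᵐ[volume.restrict Ω]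
      ((2⁻¹ : ℝ) • (a + b) : L2 Ω ℝ) := fun a b =>
    ((Lp.coeFn_add a b).symm.const_smul (2⁻¹ : ℝ)).trans (Lp.coeFn_smul _ _).symm
  exact ((h1.add h2).const_smul (2⁻¹ : ℝ)).congr (key _ _) (key _ _)

theorem InH10.formA_eq_neg_inner_divStrainL2 {v : L2 Ω (Eucl d)}
    (h : InH10 Ω v) (μ : ℝ) {u : L2 Ω (Eucl d)} (hu : MemSobolev Ω 2 u) :
    formA Ω μ u v = - (2 * μ * inner ℝ (divStrainL2 Ω u) v) := by
  have hs : ∀ i j, strainL2 Ω u (i, j) = strainL2 Ω u (j, i) := fun i j => by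
    simp only [strainL2]
    rw [add_comm]
  -- As `ε(u)` is symmetric, the antisymmetric part of `∇v` contributes nothing, and `ε(v)` may be
  -- replaced by `∇v`.
  have h1 : inner ℝ (strainL2 Ω u) (strainL2 Ω v) =
      ∑ i, ∑ j, inner ℝ (strainL2 Ω u (i, j)) (coordL2 Ω i (weakPartial Ω j v)) := by
    have h2 : ∀ i j, inner ℝ (strainL2 Ω u (i, j)) (strainL2 Ω v (i, j)) =
        2⁻¹ * inner ℝ (strainL2 Ω u (i, j)) (coordL2 Ω i (weakPartial Ω j v)) +
        2⁻¹ * inner ℝ (strainL2 Ω u (j, i)) (coordL2 Ω j (weakPartial Ω i v)) := by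
      intro i j
      rw [hs j i, ← mul_add, ← inner_add_right, ← real_inner_smul_right]
      rfl
    rw [PiLp.inner_apply, Fintype.sum_prod_type]
    simp only [h2, Finset.sum_add_distrib, ← Finset.mul_sum]
    rw [Finset.sum_comm (f := fun i j =>
      inner ℝ (strainL2 Ω u (j, i)) (coordL2 Ω j (weakPartial Ω i v)))]
    ring
  rw [formA_eq, h1, divStrainL2, sum_inner, ← mul_neg, ← Finset.sum_neg_distrib]
  congr 1
  refine Finset.sum_congr rfl fun i _ => ?_
  rw [sum_inner, ← Finset.sum_neg_distrib]
  refine Finset.sum_congr rfl fun j _ => ?_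
  rw [inner_dirL2]
  exact (hu.isWeakDeriv_strainL2 i j).inner_coordL2_eq i h.2

/-- Integration by parts rewrites the weak equation as an `L²` pairing with `v`. The fields `φ w`,
with `φ` a scalar test function and `w` a constant vector, suffice to identify `f`. -/
theorem IsElasticitySolution.strong_form (hΩ : IsOpen Ω) {μ lam : ℝ} {f u : L2 Ω (Eucl d)}
    {p : L2 Ω ℝ} (h : IsElasticitySolution Ω μ lam f u p) (hu : MemSobolev Ω 2 u)
    (hp : MemSobolev Ω 1 p) : f = -((2 * μ) • divStrainL2 Ω u) - gradL2 Ω p := by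
  set z : L2 Ω (Eucl d) := -((2 * μ) • divStrainL2 Ω u) - gradL2 Ω p with hz
  have key : ∀ v : L2 Ω (Eucl d), MemH10 Ω v → inner ℝ f v = inner ℝ z v := by
    intro v hv
    rw [← h.2.1 v hv, (hv.inH10 hΩ).formA_eq_neg_inner_divStrainL2 μ hu,
      (hv.inH10 hΩ).formB_eq_neg_inner_gradL2 hΩ hp, hz, inner_sub_left, inner_neg_left,
      real_inner_smul_left]
    ring
  refine L2.eq_of_forall_isTest hΩ fun φ hφ => ?_
  refine ext_inner_left ℝ fun w => ?_
  have ht : IsTest Ω fun x => φ x • w := hφ.smul_const w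
  have hk := key ((ht.memLp 2).toLp _) (ht.memH10 (MemLp.coeFn_toLp _))
  have hi : ∀ g : L2 Ω (Eucl d), inner ℝ g ((ht.memLp 2).toLp fun x => φ x • w) =
      inner ℝ w (∫ x in Ω, φ x • g x) := by
    intro g
    rw [L2.inner_def, ← integral_inner (hφ.integrable_smul (Lp.memLp g))]
    refine integral_congr_ae ?_
    filter_upwards [MemLp.coeFn_toLp (ht.memLp 2)] with x hx
    rw [hx, real_inner_smul_right, real_inner_smul_right, real_inner_comm]
  rwa [hi, hi] at hk

/-- The weak derivatives of `div ε(u)` are bounded by those of `u` of two orders more. -/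
theorem MemSobolev.exists_isWeakDeriv_divStrainL2 {m : ℕ} {u : L2 Ω (Eucl d)}
    (hu : MemSobolev Ω (m + 2) u) {j : ℕ} (hj : j ≤ m) (I : Fin j → Fin d) :
    ∃ g, IsWeakDeriv Ω I (divStrainL2 Ω u) g ∧ ∀ T ⊆ Ω, IsOpen T →
      eLpNorm g 2 (volume.restrict T) ≤ (d ^ 2 : ℕ) * sobolevNorm T (m + 2) u := by
  -- The derivatives of `u` are chosen once on `Ω`; their restrictions serve every `T`
  -- simultaneously.
  have hex : ∀ a b : Fin d, ∃ g, IsWeakDeriv Ω (Matrix.vecCons a (Matrix.vecCons b I)) u g :=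
    fun a b => hu _ (by omega) _
  choose G hG using hex
  have hu1 : MemSobolev Ω 1 u := hu.of_le (by omega)
  have h2 : ∀ a b, IsWeakDeriv Ω I (weakPartial Ω b (weakPartial Ω a u)) (G a b) :=
    fun a b => (((hu.memSobolev_weakPartial a).of_le (by omega)).isWeakDeriv_weakPartial b).of_cons
      ((hu1.isWeakDeriv_weakPartial a).of_cons (hG a b))
  -- `L i j` sends `x` to `x_j e_i`. It assembles `div ε(u)` from the terms `(∂_l ∂_l u_i + ∂_l ∂_i
  -- u_l) e_i / 2`, one for each of the `d²` pairs `(i, l)`.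
  let L : Fin d → Fin d → Eucl d →L[ℝ] Eucl d := fun i j =>
    (EuclideanSpace.proj j : Eucl d →L[ℝ] ℝ).smulRight (EuclideanSpace.single i (1 : ℝ))
  have hL : ∀ i j x, ‖L i j x‖ ≤ ‖x‖ := fun i j x => by
    simpa [L, norm_smul] using PiLp.norm_apply_le x j
  let g : Fin d → Fin d → Eucl d → Eucl d := fun i j =>
    (2⁻¹ : ℝ) • ((fun x => L i i (G j j x)) + fun x => L i j (G i j x))
  have hT : ∀ i l, IsWeakDeriv Ω I ((2⁻¹ : ℝ) •
      ((fun x => L i i (weakPartial Ω l (weakPartial Ω l u) x)) +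
        fun x => L i l (weakPartial Ω l (weakPartial Ω i u) x))) (g i l) :=
    fun i l => (((h2 l l).clm_comp (L i i)).add ((h2 i l).clm_comp (L i l))).const_smul _
  refine ⟨∑ i, ∑ l, g i l, ?_, ?_⟩
  · refine (IsWeakDeriv.sum Finset.univ fun i _ => IsWeakDeriv.sum Finset.univ fun l _ =>
      hT i l).congr ?_ (ae_eq_refl _)
    have hd : ∀ i l, dirL2 Ω i ((2⁻¹ : ℝ) •
        (coordL2 Ω i (weakPartial Ω l (weakPartial Ω l u)) +
          coordL2 Ω l (weakPartial Ω l (weakPartial Ω i u)))) =ᵐ[volume.restrict Ω]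
        ((2⁻¹ : ℝ) • ((fun x => L i i (weakPartial Ω l (weakPartial Ω l u) x)) +
        fun x => L i l (weakPartial Ω l (weakPartial Ω i u) x))) := by
      intro i l
      refine (dirL2_ae i _).trans ?_
      filter_upwards [Lp.coeFn_smul (2⁻¹ : ℝ)
          (coordL2 Ω i (weakPartial Ω l (weakPartial Ω l u)) +
            coordL2 Ω l (weakPartial Ω l (weakPartial Ω i u))),
        Lp.coeFn_add (coordL2 Ω i (weakPartial Ω l (weakPartial Ω l u)))
          (coordL2 Ω l (weakPartial Ω l (weakPartial Ω i u))),
        coordL2_ae i (weakPartial Ω l (weakPartial Ω l u)),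
        coordL2_ae l (weakPartial Ω l (weakPartial Ω i u))] with x h1 h2 h3 h4
      rw [h1, Pi.smul_apply, h2, Pi.add_apply, h3, h4]
      simp [L, smul_smul, mul_add, add_smul]
    have hin : ∀ i, (∑ l, dirL2 Ω i ((2⁻¹ : ℝ) •
        (coordL2 Ω i (weakPartial Ω l (weakPartial Ω l u)) +
          coordL2 Ω l (weakPartial Ω l (weakPartial Ω i u)))) : L2 Ω (Eucl d))
        =ᵐ[volume.restrict Ω] _ := fun i => Lp.coeFn_fun_finsetSum Finset.univ _
    filter_upwards [Lp.coeFn_fun_finsetSum Finset.univ fun i => ∑ l, dirL2 Ω i ((2⁻¹ : ℝ) •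
        (coordL2 Ω i (weakPartial Ω l (weakPartial Ω l u)) +
          coordL2 Ω l (weakPartial Ω l (weakPartial Ω i u)))),
      ae_all_iff.2 hin, ae_all_iff.2 fun i => ae_all_iff.2 (hd i)] with x h1 h2 h3
    rw [divStrainL2, h1]
    simp only [h2, h3, Finset.sum_apply]
  · intro T hTΩ hTo
    have hm : ∀ i l, AEStronglyMeasurable (g i l) (volume.restrict T) :=
      fun i l => ((hT i l).mono hTΩ).2.1.1
    have hG' : ∀ a b, eLpNorm (G a b) 2 (volume.restrict T) ≤ sobolevNorm T (m + 2) u :=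
      fun a b => ((hG a b).mono hTΩ).eLpNorm_le_sobolevNorm hTo (by omega)
    have hg : ∀ i l, eLpNorm (g i l) 2 (volume.restrict T) ≤ sobolevNorm T (m + 2) u := by
      intro i l
      have hLG : ∀ i j a b, eLpNorm (fun x => L i j (G a b x)) 2 (volume.restrict T) ≤
          sobolevNorm T (m + 2) u := fun i j a b =>
        (eLpNorm_mono fun x => hL i j _).trans (hG' a b)
      have ha : ∀ i j a b, AEStronglyMeasurable (fun x => L i j (G a b x))
          (volume.restrict T) := fun i j a b =>
        (L i j).continuous.comp_aestronglyMeasurable ((hG a b).mono hTΩ).2.1.1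
      calc eLpNorm (g i l) 2 (volume.restrict T)
          ≤ ‖(2⁻¹ : ℝ)‖ₑ * eLpNorm ((fun x => L i i (G l l x)) + fun x => L i l (G i l x)) 2
            (volume.restrict T) := eLpNorm_const_smul_le
        _ ≤ ‖(2⁻¹ : ℝ)‖ₑ * (sobolevNorm T (m + 2) u + sobolevNorm T (m + 2) u) := by
          gcongr
          exact (eLpNorm_add_le (ha _ _ _ _) (ha _ _ _ _) (by norm_num)).trans
            (add_le_add (hLG _ _ _ _) (hLG _ _ _ _))
        _ = sobolevNorm T (m + 2) u := by
          rw [← two_mul, ← mul_assoc, Real.enorm_of_nonneg (by norm_num),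
            ENNReal.ofReal_inv_of_pos two_pos, ENNReal.ofReal_ofNat,
            ENNReal.inv_mul_cancel two_ne_zero (by simp), one_mul]
    calc eLpNorm (∑ i, ∑ l, g i l) 2 (volume.restrict T)
        ≤ ∑ i, ∑ l, eLpNorm (g i l) 2 (volume.restrict T) := by
          refine (eLpNorm_sum_le (fun i _ => Finset.aestronglyMeasurable_sum _ fun l _ => hm i l)
            (by norm_num)).trans (Finset.sum_le_sum fun i _ => ?_)
          exact eLpNorm_sum_le (fun l _ => hm i l) (by norm_num)
      _ ≤ ∑ _i : Fin d, ∑ _l : Fin d, sobolevNorm T (m + 2) u :=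
          Finset.sum_le_sum fun i _ => Finset.sum_le_sum fun l _ => hg i l
      _ = _ := by simp [sq, mul_assoc]

theorem MemSobolev.memSobolev_divStrainL2 {m : ℕ} {u : L2 Ω (Eucl d)}
    (hu : MemSobolev Ω (m + 2) u) :
    MemSobolev Ω m (divStrainL2 Ω u) := fun _ hj I =>
  (hu.exists_isWeakDeriv_divStrainL2 hj I).imp fun _ hg => hg.1

theorem MemSobolev.sobolevNorm_divStrainL2_le {m : ℕ} {u : L2 Ω (Eucl d)}
    (hu : MemSobolev Ω (m + 2) u) {T : Set (Eucl d)} (hTΩ : T ⊆ Ω) (hT : IsOpen T) :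
    sobolevNorm T m (divStrainL2 Ω u) ≤
      (numDerivs d m * d ^ 2 : ℕ) * sobolevNorm T (m + 2) u := by
  rw [Nat.cast_mul, mul_assoc]
  refine sobolevNorm_le_of_forall fun j hj I => ?_
  obtain ⟨g, hg, hgT⟩ := hu.exists_isWeakDeriv_divStrainL2 hj I
  exact ⟨g, hg.mono hTΩ, hgT T hTΩ hT⟩

end StrongForm

/-! ### Approximation, consistency and the error equation -/

namespace MixedDiscretization

variable {d : ℕ} {Ω : Set (Eucl d)} (D : MixedDiscretization Ω)

theorem norm_le_of_cells {F : Type} [NormedAddCommGroup F] (w : L2 Ω F) {a : ℝ} (ha : 0 ≤ a)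
    {S : Set (Eucl d) → ℝ≥0∞} {B : ℝ≥0∞} (hB : B ≠ ⊤) (hS : ∑ T ∈ D.cells, S T ^ 2 ≤ B ^ 2)
    (h : ∀ T ∈ D.cells, eLpNorm w 2 (volume.restrict T) ≤ ENNReal.ofReal a * S T) :
    ‖w‖ ≤ a * B.toReal := by
  rw [Lp.norm_def, ← ENNReal.toReal_ofReal ha, ← ENNReal.toReal_mul]
  exact ENNReal.toReal_mono (ENNReal.mul_ne_top ENNReal.ofReal_ne_top hB)
    (D.eLpNorm_le_of_cells w hS h)

/-- Needed to cancel a power of `h_T`. A nonempty open set is not a single point here, and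
boundedness excludes the default diameter `0` of unbounded sets. -/
theorem diam_pos [Nontrivial (Eucl d)] (hΩ : Bornology.IsBounded Ω) {T : Set (Eucl d)}
    (hT : T ∈ D.cells) : 0 < Metric.diam T := by
  refine Metric.diam_pos ?_ (hΩ.subset (D.cells_subset T hT))
  by_contra h
  obtain ⟨x, hx⟩ := D.cells_nonempty T hT
  have := (Set.not_nontrivial_iff.1 h).eq_singleton_of_mem hx
  exact not_isOpen_singleton x (this ▸ D.cells_open T hT)

variable {D}

/-- The approximation property of `V_h` in the energy norm. -/
theorem FESpaceAssumption.exists_gradNorm_sub_le [Nontrivial (Eucl d)] (hΩ : IsOpen Ω)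
    (hΩb : Bornology.IsBounded Ω) {k : ℕ} {C β : ℝ} (hC : 0 < C)
    (h : D.FESpaceAssumption k C β) {u : L2 Ω (Eucl d)} (hu : MemSobolev Ω (k + 1) u)
    (hu0 : MemH10 Ω u) : ∃ w ∈ D.V, gradNorm Ω (u - w) ≤
      d * (C * D.meshSize ^ k * (sobolevNorm Ω (k + 1) u).toReal) := by
  obtain ⟨Ih, hIh⟩ := h.interpolation
  obtain ⟨hV, hT⟩ := hIh u hu hu0
  have hh := D.meshSize_nonneg
  refine ⟨Ih u, hV, gradNorm_le_of_forall (by positivity) fun i => ?_⟩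
  have hu1 : MemSobolev Ω 1 u := hu0.1
  have hw1 : MemSobolev Ω 1 (Ih u) := (D.V_sub _ hV).1
  have hd := (hw1.sub_L2 hu1).isWeakDeriv_weakPartial i
  rw [hu1.weakPartial_sub hΩ hw1, norm_sub_rev, ← hw1.weakPartial_sub hΩ hu1]
  refine D.norm_le_of_cells _ (by positivity) hu.sobolevNorm_lt_top.ne
    (D.sum_sobolevNorm_sq_le hΩ hu) fun T hTc => ?_
  refine ((hd.mono (D.cells_subset T hTc)).eLpNorm_le_sobolevNorm (D.cells_open T hTc)
    le_rfl).trans ?_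
  have hp := D.diam_pos hΩb hTc
  have h1 := hT T hTc 1 le_rfl
  -- The interpolation estimate for `i = 1` has a factor `h_T` on the left; cancelling it leaves the
  -- order `h_T^k`.
  have h2 : C * Metric.diam T ^ (k + 1) = Metric.diam T ^ 1 * (C * Metric.diam T ^ k) := by ring
  rw [h2, ENNReal.ofReal_mul (by positivity), mul_assoc,
    ENNReal.mul_le_mul_iff_right (by simpa using hp) ENNReal.ofReal_ne_top] at h1
  refine h1.trans ?_
  gcongr
  exact D.diam_le_meshSize hTc

theorem ReconAssumption.norm_sub_le (hΩ : IsOpen Ω) {C : ℝ} (hC : 0 < C)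
    (h : D.ReconAssumption C) (v : D.V) :
    ‖D.recon v - (v : L2 Ω (Eucl d))‖ ≤
      C * D.meshSize * gradNorm Ω (v : L2 Ω (Eucl d)) := by
  have hh := D.meshSize_nonneg
  have hv : MemSobolev Ω 1 (v : L2 Ω (Eucl d)) := (D.V_sub _ v.2).1
  have hs := sobolevSeminorm_one_eq hΩ hv
  rw [← ENNReal.toReal_ofReal (gradNorm_nonneg (Ω := Ω) (v : L2 Ω (Eucl d))), ← hs]
  refine D.norm_le_of_cells _ (by positivity) (hs ▸ ENNReal.ofReal_ne_top)
    (D.sum_sobolevSeminorm_sq_le hΩ 1 (hv 1 le_rfl)) fun T hT => ?_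
  refine (h.approx v T hT 1 le_rfl).trans ?_
  rw [pow_one]
  gcongr
  exact D.diam_le_meshSize hT

/-- Here `k = m + 1`, so `Q̃_h` approximates to order `k - 1 = m`, which matches `div ε(u)` in `H^m`
for `u` in `H^(m+2)`. -/
theorem FESpaceAssumption.norm_starProjection_divStrainL2_sub_le (hΩ : IsOpen Ω) {m : ℕ}
    {C β : ℝ} (hC : 0 < C) (h : D.FESpaceAssumption (m + 1) C β) {u : L2 Ω (Eucl d)}
    (hu : MemSobolev Ω (m + 2) u) :
    ‖D.Qt.starProjection (divStrainL2 Ω u) - divStrainL2 Ω u‖ ≤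
      (C * D.meshSize ^ m * (numDerivs d m * d ^ 2 : ℕ)) *
        (sobolevNorm Ω (m + 2) u).toReal := by
  have hh := D.meshSize_nonneg
  refine D.norm_le_of_cells _ (by positivity) hu.sobolevNorm_lt_top.ne
    (D.sum_sobolevNorm_sq_le hΩ hu) fun T hT => ?_
  refine (h.projection_aux _ hu.memSobolev_divStrainL2 T hT).trans ?_
  rw [ENNReal.ofReal_mul (p := C * D.meshSize ^ m) (by positivity), ENNReal.ofReal_natCast,
    mul_assoc]
  gcongr
  · exact pow_le_pow_left₀ Metric.diam_nonneg (D.diam_le_meshSize hT) m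
  · exact hu.sobolevNorm_divStrainL2_le (D.cells_subset T hT) (D.cells_open T hT)

/-- The error equation: the pressure enters only through `p_h - π p`. -/
theorem IsModifiedSolution.error_equation (hΩ : IsOpen Ω) {μ lam : ℝ} {f u uh : L2 Ω (Eucl d)}
    {p ph : L2 Ω ℝ} (hs : IsElasticitySolution Ω μ lam f u p) (hu : MemSobolev Ω 2 u)
    (hp : MemSobolev Ω 1 p) (hd : D.IsModifiedSolution μ lam f uh ph) (v : D.V) :
    formA Ω μ (uh - u) v + formB Ω (ph - D.Q.starProjection p) v =
      2 * μ * inner ℝ (divStrainL2 Ω u) ((v : L2 Ω (Eucl d)) - D.recon v) := by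
  have hv := (D.V_sub _ v.2).inH10 hΩ
  have h1 := hd.2.2.1 v
  -- The divergence of `π^div v` lies in `Q_h`, so it sees only `πp`, and on `Q_h` it acts as the
  -- divergence of `v`.
  have h2 : inner ℝ p (weakDiv Ω (D.recon v)) = formB Ω (D.Q.starProjection p) v := by
    rw [← D.recon_comm v _ (D.Q.starProjection_apply_mem p), formB,
      D.Q.inner_starProjection_left_eq_right,
      Submodule.starProjection_eq_self_iff.2 (D.recon_div_mem v)]
  rw [hs.strong_form hΩ hu hp, inner_sub_left, (D.recon_trace v).inner_gradL2_eq hp,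
    inner_neg_left, real_inner_smul_left, h2] at h1
  rw [formA_sub_left hΩ μ (D.V_sub _ hd.1).1 hs.1.1, formB_sub_left,
    hv.formA_eq_neg_inner_divStrainL2 μ hu, inner_sub_right]
  linarith

/-- Since `v - π^div v` is orthogonal to `Q̃_h`, the projection of `div ε(u)` may be subtracted. The
projection error supplies `h^m`, the reconstruction error one more `h`. -/
theorem ReconAssumption.abs_inner_le (hΩ : IsOpen Ω) {m : ℕ} {C β : ℝ} (hC : 0 < C)
    (hF : D.FESpaceAssumption (m + 1) C β) (hR : D.ReconAssumption C) {u : L2 Ω (Eucl d)}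
    (hu : MemSobolev Ω (m + 2) u) (v : D.V) :
    |inner ℝ (divStrainL2 Ω u) ((v : L2 Ω (Eucl d)) - D.recon v)| ≤
      C ^ 2 * (numDerivs d m * d ^ 2 : ℕ) *
        (D.meshSize ^ (m + 1) * (sobolevNorm Ω (m + 2) u).toReal) *
          gradNorm Ω (v : L2 Ω (Eucl d)) := by
  have h1 : inner ℝ (divStrainL2 Ω u) ((v : L2 Ω (Eucl d)) - D.recon v) =
      inner ℝ (divStrainL2 Ω u - D.Qt.starProjection (divStrainL2 Ω u))
        ((v : L2 Ω (Eucl d)) - D.recon v) := by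
    rw [inner_sub_left, real_inner_comm _ (D.Qt.starProjection _),
      hR.ortho v _ (D.Qt.starProjection_apply_mem _), sub_zero]
  rw [h1]
  refine (abs_real_inner_le_norm _ _).trans ?_
  rw [norm_sub_rev, norm_sub_rev (v : L2 Ω (Eucl d))]
  have hh := D.meshSize_nonneg
  calc _ ≤ ((C * D.meshSize ^ m * (numDerivs d m * d ^ 2 : ℕ)) *
        (sobolevNorm Ω (m + 2) u).toReal) *
          (C * D.meshSize * gradNorm Ω (v : L2 Ω (Eucl d))) :=
        mul_le_mul (hF.norm_starProjection_divStrainL2_sub_le hΩ hC hu)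
          (hR.norm_sub_le hΩ hC v) (norm_nonneg _) (by positivity)
    _ = _ := by ring

/-- The pressure error has mean value zero if the constants are in `Q_h`. -/
theorem IsModifiedSolution.integral_sub_eq_zero (hΩ : IsOpen Ω) {μ lam : ℝ} (hlam : 0 < lam)
    {f u uh : L2 Ω (Eucl d)} {p ph : L2 Ω ℝ} (hs : IsElasticitySolution Ω μ lam f u p)
    (hd : D.IsModifiedSolution μ lam f uh ph) {r : L2 Ω ℝ} (hrQ : r ∈ D.Q)
    (hr : r =ᵐ[volume.restrict Ω] fun _ => (1 : ℝ)) :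
    ∫ x in Ω, (ph - D.Q.starProjection p : L2 Ω ℝ) x = 0 := by
  have h1 : ∫ x in Ω, (ph - D.Q.starProjection p : L2 Ω ℝ) x =
      inner ℝ (ph - D.Q.starProjection p) r := by
    rw [L2.inner_def]
    refine integral_congr_ae ?_
    filter_upwards [hr] with x hx
    simp [hx]
  -- Both second equations are tested with the constant `1`. As `b(1, ·)` vanishes on `H^1_0`, both
  -- pressures have mean zero, and projecting onto a space containing `1` preserves this.
  have h2 := hd.2.2.2 r hrQ
  have h3 := hs.2.2 r
  rw [((D.V_sub _ hd.1).inH10 hΩ).formB_one hΩ hr] at h2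
  rw [(hs.1.inH10 hΩ).formB_one hΩ hr] at h3
  have hl : (1 : ℝ) / lam ≠ 0 := by positivity
  have h4 : inner ℝ ph r = 0 := by simpa [hlam.ne'] using h2
  have h5 : inner ℝ p r = 0 := by simpa [hlam.ne'] using h3
  rw [h1, inner_sub_left, D.Q.inner_starProjection_left_eq_right,
    Submodule.starProjection_eq_self_iff.2 hrQ, h4, h5, sub_zero]

/-- Subtracting the second equations tested with `r = p_h - πp` gives `‖r‖²/λ`, because `p` and `πp`
agree against elements of `Q_h`. -/
theorem IsModifiedSolution.formB_sub_nonneg (hΩ : IsOpen Ω) {μ lam : ℝ} (hlam : 0 < lam)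
    {f u uh : L2 Ω (Eucl d)} {p ph : L2 Ω ℝ} (hs : IsElasticitySolution Ω μ lam f u p)
    (hd : D.IsModifiedSolution μ lam f uh ph) :
    0 ≤ formB Ω (ph - D.Q.starProjection p) (uh - u) := by
  set r := ph - D.Q.starProjection p with hr
  have hrQ : r ∈ D.Q := D.Q.sub_mem hd.2.1 (D.Q.starProjection_apply_mem p)
  have h2 := hd.2.2.2 r hrQ
  have h3 := hs.2.2 r
  have h4 : inner ℝ p r = inner ℝ (D.Q.starProjection p) r := by
    rw [D.Q.inner_starProjection_left_eq_right, Submodule.starProjection_eq_self_iff.2 hrQ]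
  have h5 : formB Ω r (uh - u) = 1 / lam * inner ℝ r r := by
    rw [formB_sub_right hΩ r (D.V_sub _ hd.1).1 hs.1.1]
    nth_rewrite 4 [hr]
    rw [inner_sub_left, ← h4]
    linarith
  rw [h5]
  exact mul_nonneg (by positivity) real_inner_self_nonneg

end MixedDiscretization

/-! ### The energy estimate and the theorem -/

theorem le_of_sq_le_mul_add_sq {x X A B : ℝ} (hX : 0 ≤ X) (hA : 0 ≤ A) (hB : 0 ≤ B)
    (h : x ^ 2 ≤ A * X * x + B * X ^ 2) : x ≤ (A + B + 1) * X := by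
  by_contra! hlt
  -- If the claim fails then `X ≤ x`, so `X²` may be replaced by `X x` and one factor `x` cancelled.
  have hXx : X ≤ x := by nlinarith [mul_nonneg (add_nonneg hA hB) hX]
  have hx : 0 < x := lt_of_le_of_lt (by positivity) hlt
  have h1 : x * x ≤ ((A + B) * X) * x := by
    nlinarith [mul_le_mul_of_nonneg_left hXx (mul_nonneg hB hX)]
  linarith [le_of_mul_le_mul_right h1 hx]

/-- The estimate of the energy norm of the error, in terms of the constants of the
interpolation (`c₁`) and of the consistency error (`c₂`). -/
theorem MixedDiscretization.IsModifiedSolution.gradNorm_sub_le {d : ℕ} {Ω : Set (Eucl d)}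
    {D : MixedDiscretization Ω} (hΩ : IsOpen Ω) {β : ℝ} (hβ : 0 < β) (hI : D.InfSup β)
    {μ lam : ℝ} (hμ : 0 < μ) (hlam : 0 < lam)
    {f u uh : L2 Ω (Eucl d)} {p ph : L2 Ω ℝ} (hs : IsElasticitySolution Ω μ lam f u p)
    (hu : MemSobolev Ω 2 u) (hp : MemSobolev Ω 1 p) (hd : D.IsModifiedSolution μ lam f uh ph)
    {X c₁ c₂ : ℝ} (hX : 0 ≤ X) (hc₁ : 0 ≤ c₁) (hc₂ : 0 ≤ c₂)
    (hw : ∃ w ∈ D.V, gradNorm Ω (u - w) ≤ c₁ * X)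
    (hg : ∀ v : D.V, |inner ℝ (divStrainL2 Ω u) ((v : L2 Ω (Eucl d)) - D.recon v)| ≤
      c₂ * X * gradNorm Ω (v : L2 Ω (Eucl d))) :
    gradNorm Ω (u - uh) ≤ ((2 * c₂ + 4 * d / β * c₁ + 2 * c₁) +
      (2 * c₁ * c₂ + 2 * d / β * c₁ * c₂) + 1) * X := by
  obtain ⟨w, hwV, hw⟩ := hw
  have hu1 := hs.1.1
  have huh := (D.V_sub _ hd.1).1
  have hw1 := (D.V_sub _ hwV).1
  have heV : uh - w ∈ D.V := D.V.sub_mem hd.1 hwV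
  have he1 := (D.V_sub _ heV).1
  have hδ1 := hu1.sub_L2 hw1
  set r := ph - D.Q.starProjection p with hr
  set η := uh - u with hη
  have hη1 : MemSobolev Ω 1 η := huh.sub_L2 hu1
  have hrQ : r ∈ D.Q := D.Q.sub_mem hd.2.1 (D.Q.starProjection_apply_mem p)
  have hsymm : gradNorm Ω (u - uh) = gradNorm Ω η := by
    simp only [gradNorm, hη, hu1.weakPartial_sub hΩ huh, huh.weakPartial_sub hΩ hu1]
    simp only [norm_sub_rev]
  have hbv : ∀ v : D.V, |formA Ω μ η v + formB Ω r v| ≤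
      2 * μ * (c₂ * X * gradNorm Ω (v : L2 Ω (Eucl d))) := by
    intro v
    rw [hr, hη, hd.error_equation hΩ hs hu hp v, abs_mul, abs_of_pos (by positivity)]
    exact mul_le_mul_of_nonneg_left (hg v) (by positivity)
  have hx := gradNorm_nonneg (Ω := Ω) η
  have hδ := gradNorm_nonneg (Ω := Ω) (u - w)
  -- The error equation bounds `b(r, v)` by `2μ (|η|_1 + c₂ X) |v|_1`; the inf-sup condition turns
  -- this into a bound for the pressure error proportional to `μ`.
  have hρ : β * ‖r‖ ≤ 2 * μ * (gradNorm Ω η + c₂ * X) := by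
    refine (hI r hrQ ?_).trans (Real.iSup_le (fun v => ?_) (by positivity))
    · rintro ⟨q, hq, hq1⟩
      exact hd.integral_sub_eq_zero hΩ hlam hs hq hq1
    · have hv := (D.V_sub _ v.2).1
      rw [sobolevSeminorm_one_eq hΩ hv, ENNReal.toReal_ofReal (gradNorm_nonneg _)]
      refine div_le_of_le_mul₀ (gradNorm_nonneg _) (by positivity) ?_
      have h1 := (abs_le.1 (hbv v)).2
      have h2 := (abs_le.1 (abs_formA_le hμ η (v : L2 Ω (Eucl d)))).1
      linarith
  have hsplit : η = (uh - w) - (u - w) := by rw [hη]; abel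
  have hex : gradNorm Ω (uh - w) ≤ gradNorm Ω η + gradNorm Ω (u - w) := by
    have h1 : uh - w = η - (w - u) := by rw [hη]; abel
    have h2 : gradNorm Ω (w - u) = gradNorm Ω (u - w) := by
      simp only [gradNorm, hu1.weakPartial_sub hΩ hw1, hw1.weakPartial_sub hΩ hu1]
      simp only [norm_sub_rev]
    rw [h1, ← h2]
    exact _root_.gradNorm_sub_le hΩ hη1 (hw1.sub_L2 hu1)
  have ha : formA Ω μ η η = formA Ω μ η (uh - w) - formA Ω μ η (u - w) := by
    conv_lhs => arg 4; rw [hsplit]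
    exact formA_sub_right hΩ μ he1 hδ1 η
  have hb : formB Ω r η = formB Ω r (uh - w) - formB Ω r (u - w) := by
    conv_lhs => arg 3; rw [hsplit]
    exact formB_sub_right hΩ r he1 hδ1
  have hb0 : 0 ≤ formB Ω r η := hd.formB_sub_nonneg hΩ hlam hs
  have hcoer := (((D.V_sub _ hd.1).inH10 hΩ).sub hΩ (hs.1.inH10 hΩ)).le_formA hμ
  have h1 := (abs_le.1 (hbv ⟨uh - w, heV⟩)).2
  have h2 := (abs_le.1 (abs_formA_le hμ η (u - w))).1
  have h3 := (abs_le.1 (abs_formB_le hΩ r hδ1)).1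
  have hρ' : ‖r‖ ≤ 2 * μ * (gradNorm Ω η + c₂ * X) / β := by
    rw [le_div_iff₀ hβ]; linarith
  rw [hsymm]
  refine le_of_sq_le_mul_add_sq hX (by positivity) (by positivity) ?_
  have h4 : ‖r‖ * gradNorm Ω (u - w) ≤
      2 * μ * (gradNorm Ω η + c₂ * X) / β * (c₁ * X) := by gcongr
  have h5 : c₂ * X * gradNorm Ω (uh - w) ≤ c₂ * X * (gradNorm Ω η + c₁ * X) := by
    gcongr; linarith
  have h6 : gradNorm Ω η * gradNorm Ω (u - w) ≤ gradNorm Ω η * (c₁ * X) := by gcongr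
  -- Coercivity, with `a(η, η)` split along `η = (u_h - w) - (u - w)`. The error equation handles
  -- `a(η, u_h - w)` up to `-b(r, u_h - w)`, which is at most `-b(r, u - w)` because `b(r, η) ≥ 0`.
  have h7 : μ * gradNorm Ω η ^ 2 ≤ 2 * μ * (c₂ * X * (gradNorm Ω η + c₁ * X)) +
      d * (2 * μ * (gradNorm Ω η + c₂ * X) / β * (c₁ * X)) +
        2 * μ * (gradNorm Ω η * (c₁ * X)) := by
    have h4' := mul_le_mul_of_nonneg_left h4 (Nat.cast_nonneg (α := ℝ) d)
    have h5' := mul_le_mul_of_nonneg_left h5 (by positivity : 0 ≤ 2 * μ)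
    have h6' := mul_le_mul_of_nonneg_left h6 (by positivity : 0 ≤ 2 * μ)
    simp only at h1
    linarith
  refine le_of_mul_le_mul_left (h7.trans ?_) hμ
  -- The coefficient `4d/β` is twice what the estimate requires; this is the surplus.
  have h8 : 0 ≤ μ * (2 * d / β * c₁ * X * gradNorm Ω η) := by positivity
  have h9 : μ * ((2 * c₂ + 4 * d / β * c₁ + 2 * c₁) * X * gradNorm Ω η +
      (2 * c₁ * c₂ + 2 * d / β * c₁ * c₂) * X ^ 2) =
      2 * μ * (c₂ * X * (gradNorm Ω η + c₁ * X)) +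
      d * (2 * μ * (gradNorm Ω η + c₂ * X) / β * (c₁ * X)) +
        2 * μ * (gradNorm Ω η * (c₁ * X)) + μ * (2 * d / β * c₁ * X * gradNorm Ω η) := by
    ring
  linarith

theorem mainTheorem4 {d : ℕ} (hd : d = 2 ∨ d = 3) (Ω : Set (Eucl d)) (hΩ : IsOpen Ω)
    (hΩb : Bornology.IsBounded Ω) (k : ℕ) (hk : 2 ≤ k) (σ C β : ℝ) (hσ : 0 < σ) (hC : 0 < C)
    (hβ : 0 < β) :
    ∃ c : ℝ, 0 < c ∧ ∀ D : MixedDiscretization Ω, D.ShapeRegular σ →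
      D.FESpaceAssumption k C β → D.ReconAssumption C →
      ∀ (μ lam : ℝ), 0 < μ → 0 < lam →
      ∀ (f u : L2 Ω (Eucl d)) (p : L2 Ω ℝ), IsElasticitySolution Ω μ lam f u p →
      MemSobolev Ω (k + 1) u → MemSobolev Ω k p →
      ∀ (uh : L2 Ω (Eucl d)) (ph : L2 Ω ℝ), D.IsModifiedSolution μ lam f uh ph →
        sobolevNorm Ω 1 ⇑(u - uh) ≤
          ENNReal.ofReal (c * D.meshSize ^ k * (1 + Real.sqrt (μ / lam))) *
              sobolevNorm Ω (k + 1) u +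
            ENNReal.ofReal (c * D.meshSize ^ k / (μ * lam)) * sobolevNorm Ω k p := by
  have : Nontrivial (Eucl d) := by rcases hd with rfl | rfl <;> infer_instance
  obtain ⟨m, rfl⟩ : ∃ m, k = m + 1 := ⟨k - 1, by omega⟩
  obtain ⟨R, hR0, hR⟩ := hΩb.exists_pos_norm_le
  set c₁ : ℝ := d * C with hc₁
  set c₂ : ℝ := C ^ 2 * (numDerivs d m * d ^ 2 : ℕ) with hc₂
  have hc₁0 : 0 ≤ c₁ := by positivity
  have hc₂0 : 0 ≤ c₂ := by positivity
  set c₀ : ℝ := (2 * c₂ + 4 * d / β * c₁ + 2 * c₁) +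
    (2 * c₁ * c₂ + 2 * d / β * c₁ * c₂) + 1 with hc₀
  have hc₀0 : 0 < c₀ := by positivity
  -- `2R` is the Poincaré constant for the `L²` part of the norm, `1` accounts for the gradient.
  refine ⟨(2 * R + 1) * c₀, by positivity, ?_⟩
  intro D _ hF hRec μ lam hμ hlam f u p hs hu hp uh ph hdisc
  have hh := D.meshSize_nonneg
  set N := sobolevNorm Ω (m + 1 + 1) u with hN
  have hNtop : N ≠ ⊤ := hu.sobolevNorm_lt_top.ne
  have hgrad : gradNorm Ω (u - uh) ≤ c₀ * (D.meshSize ^ (m + 1) * N.toReal) := by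
    refine hdisc.gradNorm_sub_le hΩ hβ hF.infSup hμ hlam hs (hu.of_le (by omega))
      (hp.of_le (by omega)) (by positivity) hc₁0 hc₂0 ?_ fun v => ?_
    · obtain ⟨w, hw, hle⟩ := hF.exists_gradNorm_sub_le hΩ hΩb hC hu hs.1
      exact ⟨w, hw, hle.trans_eq (by rw [hc₁]; ring)⟩
    · exact hRec.abs_inner_le hΩ hC hF hu v
  have hdiff : InH10 Ω (u - uh) := (hs.1.inH10 hΩ).sub hΩ ((D.V_sub _ hdisc.1).inH10 hΩ)
  have hpoinc : ‖u - uh‖ ≤ 2 * R * gradNorm Ω (u - uh) := by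
    have i : Fin d := ⟨0, by omega⟩
    refine (h10Graph_norm_le hΩ.measurableSet hR0.le hR i hdiff.2).trans ?_
    gcongr
    exact norm_weakPartial_le_gradNorm _ _
  have hx := gradNorm_nonneg (Ω := Ω) (u - uh)
  -- The velocity term alone already bounds the error, so the pressure term is only added.
  refine le_trans ?_ le_self_add
  rw [sobolevNorm_one_eq hΩ hdiff.1, ← ENNReal.ofReal_toReal hNtop,
    ← ENNReal.ofReal_mul (by positivity)]
  refine ENNReal.ofReal_le_ofReal ?_
  calc √(‖u - uh‖ ^ 2 + gradNorm Ω (u - uh) ^ 2) ≤ ‖u - uh‖ + gradNorm Ω (u - uh) :=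
        Real.sqrt_le_iff.2 ⟨by positivity, by nlinarith [mul_nonneg (norm_nonneg (u - uh)) hx]⟩
    _ ≤ (2 * R + 1) * gradNorm Ω (u - uh) := by linarith
    _ ≤ (2 * R + 1) * (c₀ * (D.meshSize ^ (m + 1) * N.toReal)) := by gcongr
    _ = (2 * R + 1) * c₀ * D.meshSize ^ (m + 1) * 1 * N.toReal := by ring
    _ ≤ (2 * R + 1) * c₀ * D.meshSize ^ (m + 1) * (1 + √(μ / lam)) * N.toReal := by
        gcongr
        linarith [Real.sqrt_nonneg (μ / lam)]
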